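/- Let $A$ be the generator of a bounded $C_0$-semigroup $(T(t))_{t\ge 0}$ on a complex Banach space $X$. Let $D(A)$ carry the graph norm $\|x\|+\|Ax\|$, and let $C\in\mathcal L(D(A),X)$ commute with the semigroup, i.e. $T(t)Cx=CT(t)x$ for all $x\in D(A)$ and $t\ge 0$. For $\delta>0$ let $(-A)^{\delta}$ be the fractional power of the sectorial operator $-A$, and let $C(-A)^\delta$ have its natural domain $\{x\in D((-A)^\delta): (-A)^\delta x\in D(A)\}$. Suppose that there are constants $M_1,M_2,\alpha,\beta>0$ such that for all $t>0$ $$\|C(-A)^{\alpha}T(t)x\|\le M_1\|x\|\quad (x\in D((-A)^{1+\alpha})),\qquad \|CT(t)x\|\le \frac{M_2}{\sqrt{t^{1+\beta}}}\,\|x\|\quad (x\in D(A)).$$ Then $C$ satisfies the strong $2$-Weiss condition for $A$: there is $\gamma>0$ such that $C(-A)^\gamma$ extends to an operator $E\in\mathcal L(D(A),X)$ for which there is $K>0$ with $$\|E(\lambda I-A)^{-1}\|\le \frac{K}{\sqrt{\operatorname{Re}\lambda}}\qquad\text{for all }\lambda\in\mathbb C\text{ with }\operatorname{Re}\lambda>0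 .$$ Moreover, one can take $\gamma=\alpha\beta/(1+\beta)$. -/

import Mathlib

open Filter Topology MeasureTheory
open scoped NNReal ENNReal

noncomputable section

namespace SemigroupWeiss

/-- A `C₀`-semigroup `(T(t))_{t ≥ 0}` of bounded linear operators on `X`. -/
structure C0Semigroup (X : Type*) [NormedAddCommGroup X] [NormedSpace ℂ X] where
  /-- The operators `T(t)`, `t ≥ 0`. -/
  T : ℝ≥0 → X →L[ℂ] X
  map_zero' : T 0 = ContinuousLinearMap.id ℂ X
  map_add' : ∀ s t, T (s + t) = (T s).comp (T t)
  tendsto_zero' : ∀ x, Tendsto (fun t => T t x) (𝓝 0) (𝓝 x)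

section

variable {X Y Z : Type*} [NormedAddCommGroup X] [NormedSpace ℂ X]
  [NormedAddCommGroup Y] [NormedSpace ℂ Y] [NormedAddCommGroup Z] [NormedSpace ℂ Z]

namespace C0Semigroup

/-- The semigroup is bounded: `sup_{t ≥ 0} ‖T(t)‖ < ∞`. -/
def IsBounded (S : C0Semigroup X) : Prop := ∃ M : ℝ, ∀ t, ‖S.T t‖ ≤ M

/-- `y = lim_{t ↓ 0} (T(t)x - x)/t`. -/
def HasDerivZero (S : C0Semigroup X) (x y : X) : Prop :=
  Tendsto (fun t : ℝ≥0 => ((t : ℝ) : ℂ)⁻¹ • (S.T t x - x)) (𝓝[>] 0) (𝓝 y)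

theorem HasDerivZero.unique {S : C0Semigroup X} {x y z : X}
    (h : S.HasDerivZero x y) (h' : S.HasDerivZero x z) : y = z :=
  tendsto_nhds_unique h h'

theorem HasDerivZero.add {S : C0Semigroup X} {x y x' y' : X}
    (h : S.HasDerivZero x y) (h' : S.HasDerivZero x' y') :
    S.HasDerivZero (x + x') (y + y') := by
  refine (Tendsto.add h h').congr fun t => ?_
  rw [← smul_add, map_add]
  congr 1
  abel

theorem HasDerivZero.smul {S : C0Semigroup X} {x y : X} (c : ℂ)
    (h : S.HasDerivZero x y) : S.HasDerivZero (c • x) (c • y) := by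
  refine (Tendsto.const_smul h c).congr fun t => ?_
  rw [map_smul, ← smul_sub, smul_comm]

/-- The generator `A` of the semigroup: `D(A)` consists of those `x` for which
`lim_{t ↓ 0} (T(t)x - x)/t` exists, and `Ax` is that limit. -/
def generator (S : C0Semigroup X) : X →ₗ.[ℂ] X where
  domain :=
    { carrier := {x | ∃ y, S.HasDerivZero x y}
      add_mem' := fun ⟨y, h⟩ ⟨y', h'⟩ => ⟨y + y', h.add h'⟩
      zero_mem' := ⟨0, by simp [HasDerivZero]⟩
      smul_mem' := fun c _ ⟨y, h⟩ => ⟨c • y, h.smul c⟩ }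
  toFun :=
    { toFun := fun x => x.2.choose
      map_add' := fun x y =>
        (x + y).2.choose_spec.unique (x.2.choose_spec.add y.2.choose_spec)
      map_smul' := fun c x => (c • x).2.choose_spec.unique (x.2.choose_spec.smul c) }

/-- `T(t) D(A) ⊆ D(A)`. -/
theorem map_mem_domain (S : C0Semigroup X) (t : ℝ≥0) (x : S.generator.domain) :
    S.T t x ∈ S.generator.domain := by
  obtain ⟨x, y, h⟩ := x
  refine ⟨S.T t y, (((S.T t).continuous.tendsto y).comp h).congr fun s => ?_⟩
  have e : S.T t (S.T s x) = S.T s (S.T t x) := by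
    rw [← ContinuousLinearMap.comp_apply, ← S.map_add', add_comm, S.map_add',
      ContinuousLinearMap.comp_apply]
  simp only [Function.comp_apply, map_smul, map_sub, e]

end C0Semigroup

/-- The composite `g f` of partially defined operators, with its natural domain
`{x ∈ D(f) : f x ∈ D(g)}`. -/
def pcomp (g : Y →ₗ.[ℂ] Z) (f : X →ₗ.[ℂ] Y) : X →ₗ.[ℂ] Z where
  domain :=
    { carrier := {x | ∃ h : x ∈ f.domain, f ⟨x, h⟩ ∈ g.domain}
      add_mem' := fun {x y} ⟨h, k⟩ ⟨h', k'⟩ => ⟨f.domain.add_mem h h', by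
        have := g.domain.add_mem k k'
        rwa [← f.map_add] at this⟩
      zero_mem' := ⟨f.domain.zero_mem, by
        have : f ⟨0, f.domain.zero_mem⟩ = 0 := f.map_zero
        rw [this]; exact g.domain.zero_mem⟩
      smul_mem' := fun c x ⟨h, k⟩ => ⟨f.domain.smul_mem c h, by
        have := g.domain.smul_mem c k
        rwa [← f.map_smul] at this⟩ }
  toFun :=
    { toFun := fun x => g ⟨f ⟨x, x.2.choose⟩, x.2.choose_spec⟩
      map_add' := fun x y => by
        rw [← g.map_add]
        congr 1
        exact Subtype.ext (f.map_add ⟨x, x.2.choose⟩ ⟨y, y.2.choose⟩)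
      map_smul' := fun c x => by
        rw [RingHom.id_apply, ← g.map_smul]
        congr 1
        exact Subtype.ext (f.map_smul c ⟨x, x.2.choose⟩) }

/-- The bounded operator `T` commutes with the partially defined operator `B`,
that is `T B ⊆ B T`. -/
def CommutesWith (T : X →L[ℂ] X) (B : X →ₗ.[ℂ] X) : Prop :=
  ∀ x : B.domain, ∃ h : T x ∈ B.domain, B ⟨T x, h⟩ = T (B x)

/-- `R` is a bounded two-sided inverse of `z I - A : D(A) → X`. -/
def IsResolventAt (A : X →ₗ.[ℂ] X) (z : ℂ) (R : X →L[ℂ] X) : Prop :=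
  (∀ x, ∃ h : R x ∈ A.domain, z • R x - A ⟨R x, h⟩ = x) ∧
    ∀ x : A.domain, R (z • (x : X) - A x) = x

/-- The resolvent set `ϱ(A)`. -/
def resolventSet (A : X →ₗ.[ℂ] X) : Set ℂ := {z | ∃ R, IsResolventAt A z R}

open Classical in
/-- The resolvent `R(z, A) = (z I - A)⁻¹` for `z ∈ ϱ(A)` (and `0` for other `z`). -/
def resolventOp (A : X →ₗ.[ℂ] X) (z : ℂ) : X →L[ℂ] X :=
  if h : ∃ R, IsResolventAt A z R then h.choose else 0

theorem resolventOp_mem_domain (A : X →ₗ.[ℂ] X) (z : ℂ) (x : X) :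
    resolventOp A z x ∈ A.domain := by
  unfold resolventOp
  split_ifs with h
  · exact (h.choose_spec.1 x).1
  · exact A.domain.zero_mem

/-- For `0 < α < n`, the bounded operator `(-A)^α (I - A)^{-n}`, given by Balakrishnan's
absolutely convergent integral
`Γ(n) / (Γ(α) Γ(n - α)) ∫_0^∞ t^(α-1) [(-A) (t - A)⁻¹]^n (I - A)^{-n} dt`,
where `(-A) (t - A)⁻¹ = I - t R(t, A)`. -/
def balakrishnan (A : X →ₗ.[ℂ] X) (α : ℝ) (n : ℕ) : X →L[ℂ] X :=
  ((Real.Gamma n / (Real.Gamma α * Real.Gamma (n - α)) : ℝ) : ℂ) •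
    ∫ t in Set.Ioi (0 : ℝ), ((t ^ (α - 1) : ℝ) : ℂ) •
      ((1 - (t : ℂ) • resolventOp A t) ^ n * resolventOp A 1 ^ n)

/-- The graph of the fractional power `(-A)^α`: with `n = ⌊α⌋ + 1 > α`, a pair `(x, y)` is in
the graph iff `(I - A)^{-n} y = [(-A)^α (I - A)^{-n}] x`. -/
def negPowGraph (A : X →ₗ.[ℂ] X) (α : ℝ) : Submodule ℂ (X × X) :=
  LinearMap.eqLocus
    ((resolventOp A 1 ^ (⌊α⌋₊ + 1) : X →L[ℂ] X).toLinearMap ∘ₗ LinearMap.snd ℂ X X)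
    ((balakrishnan A α (⌊α⌋₊ + 1)).toLinearMap ∘ₗ LinearMap.fst ℂ X X)

/-- The fractional power `(-A)^α`, `α > 0`, where `-A` is sectorial, that is
`(-A)^α = (I - A)^n [(-A)^α (I - A)^{-n}]` with its natural domain, where `n = ⌊α⌋ + 1`. -/
def negPow (A : X →ₗ.[ℂ] X) (α : ℝ) : X →ₗ.[ℂ] X := (negPowGraph A α).toLinearPMap

/-- The pair `(x, y)` is in the graph of the operator `(-A)^α` iff it satisfies the defining
equation (the relation is single-valued, because `(I - A)⁻¹` is injective). -/
theorem mem_graph_negPow {A : X →ₗ.[ℂ] X} (hA : (1 : ℂ) ∈ resolventSet A) (α : ℝ) (x y : X) :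
    (x, y) ∈ (negPow A α).graph ↔
      (resolventOp A 1 ^ (⌊α⌋₊ + 1)) y = balakrishnan A α (⌊α⌋₊ + 1) x := by
  have hR : IsResolventAt A 1 (resolventOp A 1) := by
    have hA' : ∃ R, IsResolventAt A 1 R := hA
    rw [resolventOp, dif_pos hA']
    exact hA'.choose_spec
  have inj : ∀ x, resolventOp A 1 x = 0 → x = 0 := by
    intro x hx
    obtain ⟨h, e⟩ := hR.1 x
    have h0 : A ⟨resolventOp A 1 x, h⟩ = 0 := by
      have : (⟨resolventOp A 1 x, h⟩ : A.domain) = 0 := Subtype.ext hx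
      rw [this, A.map_zero]
    rw [h0, hx] at e
    simpa using e.symm
  have injn : ∀ (n : ℕ) x, (resolventOp A 1 ^ n) x = 0 → x = 0 := by
    intro n
    induction n with
    | zero => intro x hx; simpa using hx
    | succ k ih =>
      intro x hx
      rw [pow_succ] at hx
      exact inj x (ih _ hx)
  rw [negPow, Submodule.toLinearPMap_graph_eq]
  · rfl
  · rintro ⟨a, b⟩ hab ha
    simp only at ha
    subst ha
    have : (resolventOp A 1 ^ (⌊α⌋₊ + 1)) b = balakrishnan A α (⌊α⌋₊ + 1) 0 := hab
    rw [map_zero] at this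
    exact injn _ _ this

/-- `C : D(A) → Y` is bounded for the graph norm `‖x‖ + ‖A x‖`, that is `C ∈ L(D(A), Y)`. -/
def GraphBounded (A : X →ₗ.[ℂ] X) (C : A.domain →ₗ[ℂ] Y) : Prop :=
  ∃ M : ℝ, ∀ x : A.domain, ‖C x‖ ≤ M * (‖(x : X)‖ + ‖A x‖)

/-- The linear map `C : D(A) → Y`, seen as an operator from `X` to `Y` with domain `D(A)`. -/
def asOp {A : X →ₗ.[ℂ] X} (C : A.domain →ₗ[ℂ] Y) : X →ₗ.[ℂ] Y := ⟨A.domain, C⟩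

/-- The `p`-Weiss condition on `C` for `A`, `1 ≤ p ≤ ∞`: there is `K > 0` with
`‖C R(z, A)‖ ≤ K / (Re z)^(1 - 1/p)` whenever `Re z > 0`. -/
def WeissCondition (p : ℝ≥0∞) (A : X →ₗ.[ℂ] X) (C : A.domain →ₗ[ℂ] Y) : Prop :=
  ∃ K : ℝ, 0 < K ∧ ∀ z : ℂ, 0 < z.re → z ∈ resolventSet A ∧
    ∀ x : X, ‖C ⟨resolventOp A z x, resolventOp_mem_domain A z x⟩‖ ≤
      K / z.re ^ (1 - (p⁻¹).toReal) * ‖x‖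

/-- `C (-A)^γ` extends to an operator in `L(D(A), Y)`, and its extension satisfies the
`2`-Weiss condition for `A`. -/
def StrongTwoWeissWith (A : X →ₗ.[ℂ] X) (C : A.domain →ₗ[ℂ] Y) (γ : ℝ) : Prop :=
  ∃ E : A.domain →ₗ[ℂ] Y, GraphBounded A E ∧
    pcomp (asOp C) (negPow A γ) ≤ asOp E ∧ WeissCondition 2 A E

/-- The strong `2`-Weiss condition on `C` for `A`. -/
def StrongTwoWeiss (A : X →ₗ.[ℂ] X) (C : A.domain →ₗ[ℂ] Y) : Prop :=
  ∃ γ : ℝ, 0 < γ ∧ StrongTwoWeissWith A C γ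

end

end SemigroupWeiss

end

/-! Put R = (I - A)⁻¹ and Q = CR, a bounded operator commuting with the semigroup. The moment
inequality ‖(-A)^γ y‖ ≤ c ‖y‖^(1-γ/α) ‖(-A)^α y‖^(γ/α), applied to y = C T(t)x, interpolates between
the two hypotheses and gives C(-A)^γ T(t)x = O(t^(-(1+β)(1-γ/α)/2)). The choice γ = αβ/(1+β) makes
this exponent -1/2, and the Laplace transform turns t^(-1/2) into Γ(1/2) (Re z)^(-1/2), which is the
2-Weiss bound. The estimates are made on the dense range of R^(n+1), n = ⌊α⌋ + 1; a bounded
extension F of C(-A)^γ R then gives E = F(I - A).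

Since A need not be injective, (-A)^(-a) is not available. Fractional powers enter through the
bounded operators (-A)^δ (s-A)^(-n) (`balak`), which are limits of (ε-A)^(-(n-δ)) [-A(s-A)⁻¹]^n as ε
→ 0 (`tendsto_shiftPow_mul_negRes_pow`). For ε > 0 the negative powers are integrals of the
semigroup against Gamma kernels, and their law of exponents is the Beta integral. In the limit this
becomes `balak_mul_balak`, which supplies the decay of Balakrishnan's integrand at infinity and
hence the interpolation (`exists_norm_balak_comp_le`). The Laplace step is
`norm_comp_resolventOp_le`, the extension step `strongTwoWeissWith_of_le`. -/

noncomputable section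

namespace SemigroupWeiss

variable {X : Type*} [NormedAddCommGroup X] [NormedSpace ℂ X]

/-! ### Orbits of a bounded semigroup and the Hille–Phillips calculus -/

namespace C0Semigroup

/-- The semigroup, extended to all of `ℝ` by `T(s) = T(0)` for `s < 0`. -/
def real (S : C0Semigroup X) (s : ℝ) : X →L[ℂ] X := S.T s.toNNReal

variable (S : C0Semigroup X)

theorem real_coe (t : ℝ≥0) : S.real t = S.T t := by simp [real]

theorem real_add {s t : ℝ} (hs : 0 ≤ s) (ht : 0 ≤ t) (x : X) :
    S.real (s + t) x = S.real s (S.real t x) := by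
  simp only [real, Real.toNNReal_add hs ht, S.map_add', ContinuousLinearMap.comp_apply]

theorem commute_T (s t : ℝ≥0) : Commute (S.T s) (S.T t) := by
  change (S.T s).comp (S.T t) = (S.T t).comp (S.T s)
  rw [← S.map_add', ← S.map_add', add_comm]

variable {S} {M : ℝ} (hM : ∀ t, ‖S.T t‖ ≤ M)
include hM

theorem norm_T_le (t : ℝ≥0) (x : X) : ‖S.T t x‖ ≤ M * ‖x‖ :=
  (S.T t).le_of_opNorm_le (hM t) x

theorem bound_nonneg : 0 ≤ M := (norm_nonneg _).trans (hM 0)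

/-- For s ≤ r, T(r)x - T(s)x = T(s)(T(r-s)x - x), so the uniform bound carries continuity at 0 to
every time, from both sides. -/
theorem continuous_orbit (x : X) : Continuous fun t => S.T t x := by
  rw [Metric.continuous_iff]
  intro t ε hε
  have hM0 := bound_nonneg hM
  have h := Metric.tendsto_nhds_nhds.1 (S.tendsto_zero' x) (ε / (M + 1)) (by positivity)
  obtain ⟨δ, hδ, h⟩ := h
  have key : ∀ s r : ℝ≥0, s ≤ r → dist r s < δ → dist (S.T r x) (S.T s x) < ε := by
    intro s r hsr hd
    have e : S.T r x = S.T s (S.T (r - s) x) := by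
      rw [← ContinuousLinearMap.comp_apply, ← S.map_add', add_tsub_cancel_of_le hsr]
    have h1 : dist (S.T (r - s) x) x < ε / (M + 1) := by
      apply h
      rw [NNReal.dist_eq] at hd ⊢
      simpa [NNReal.coe_sub hsr] using hd
    rw [dist_eq_norm] at h1 ⊢
    rw [e, ← map_sub]
    calc _ ≤ M * ‖S.T (r - s) x - x‖ := norm_T_le hM _ _
      _ ≤ (M + 1) * ‖S.T (r - s) x - x‖ := by gcongr; linarith
      _ < (M + 1) * (ε / (M + 1)) := by gcongr
      _ = ε := by field_simp
  refine ⟨δ, hδ, fun s hs => ?_⟩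
  rcases le_total s t with h' | h'
  · rw [dist_comm]; exact key s t h' (by rwa [dist_comm])
  · exact key t s h' hs

theorem continuous_real (x : X) : Continuous fun s => S.real s x :=
  (continuous_orbit hM x).comp continuous_real_toNNReal

theorem norm_real_le (s : ℝ) (x : X) : ‖S.real s x‖ ≤ M * ‖x‖ := norm_T_le hM _ x

theorem integrable_smul_real {μ : Measure ℝ} {f : ℝ → ℂ} (hf : Integrable f μ) (x : X) :
    Integrable (fun s => f s • S.real s x) μ := by
  refine (hf.norm.mul_const (M * ‖x‖)).mono'
    (hf.aestronglyMeasurable.smul (continuous_real hM x).aestronglyMeasurable)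
    (Eventually.of_forall fun s => ?_)
  rw [norm_smul]
  gcongr
  exact norm_real_le hM s x

theorem norm_integral_smul_real_le {f : ℝ → ℂ} (hf : IntegrableOn f (Set.Ioi 0)) (x : X) :
    ‖∫ s in Set.Ioi 0, f s • S.real s x‖ ≤ (∫ s in Set.Ioi 0, ‖f s‖) * M * ‖x‖ := by
  rw [mul_assoc, ← integral_mul_const]
  refine norm_integral_le_of_norm_le (hf.norm.mul_const _) (Eventually.of_forall fun s => ?_)
  rw [norm_smul]
  gcongr
  exact norm_real_le hM s x

omit hM in
/-- The Hille–Phillips calculus: `∫₀^∞ f(s) T(s) ds` for integrable `f`. -/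
def phillips (S : C0Semigroup X) (hS : S.IsBounded) (f : ℝ → ℂ)
    (hf : IntegrableOn f (Set.Ioi 0)) : X →L[ℂ] X :=
  LinearMap.mkContinuousOfExistsBound
    { toFun := fun x => ∫ s in Set.Ioi 0, f s • S.real s x
      map_add' := fun x y => by
        obtain ⟨M, hM⟩ := hS
        simp only [map_add, smul_add]
        exact integral_add (integrable_smul_real hM hf x) (integrable_smul_real hM hf y)
      map_smul' := fun c x => by
        simp only [map_smul, RingHom.id_apply]
        rw [← integral_smul]
        simp only [smul_comm c] }
    (by
      obtain ⟨M, hM⟩ := hS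
      exact ⟨_, fun x => norm_integral_smul_real_le hM hf x⟩)

omit hM in
theorem phillips_apply (hS : S.IsBounded) {f : ℝ → ℂ} (hf : IntegrableOn f (Set.Ioi 0)) (x : X) :
    S.phillips hS f hf x = ∫ s in Set.Ioi 0, f s • S.real s x := rfl

omit hM in
theorem commute_phillips [CompleteSpace X] (hS : S.IsBounded) {f : ℝ → ℂ}
    (hf : IntegrableOn f (Set.Ioi 0)) {L : X →L[ℂ] X} (hL : ∀ t, Commute L (S.T t)) :
    Commute L (S.phillips hS f hf) := by
  obtain ⟨M, hM⟩ := id hS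
  ext x
  change L (S.phillips hS f hf x) = S.phillips hS f hf (L x)
  rw [phillips_apply, phillips_apply, ← L.integral_comp_comm (integrable_smul_real hM hf x)]
  congr 1
  ext s
  rw [map_smul]
  congr 1
  exact congrArg (fun P : X →L[ℂ] X => P x) (hL s.toNNReal)

-- By Fubini and the semigroup law, convolution of kernels becomes composition of operators.
omit hM in
theorem phillips_mul [CompleteSpace X] (hS : S.IsBounded) {f g k : ℝ → ℂ}
    (hf : IntegrableOn f (Set.Ioi 0)) (hg : IntegrableOn g (Set.Ioi 0))
    (hk : IntegrableOn k (Set.Ioi 0))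
    (h : ∀ u, 0 < u → ∫ t in (0)..u, f t * g (u - t) = k u) :
    S.phillips hS f hf * S.phillips hS g hg = S.phillips hS k hk := by
  obtain ⟨M, hM⟩ := id hS
  ext x
  change S.phillips hS f hf (S.phillips hS g hg x) = _
  -- Extension by zero turns the half-line convolution into one on ℝ, where translation invariance
  -- applies. The indicators also ensure that the semigroup law is used for nonnegative times only.
  have hpos : (Set.Ioi (0 : ℝ)).indicator k = posConvolution f g (ContinuousLinearMap.mul ℝ ℂ) := by
    ext u
    by_cases hu : 0 < u
    · simp [posConvolution, hu, h u hu]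
    · simp [posConvolution, hu]
  rw [posConvolution_eq_convolution_indicator f g _ volume] at hpos
  have hF := (integrable_indicator_iff (measurableSet_Ioi (a := (0 : ℝ)))).2 hf
  have hG := (integrable_indicator_iff (measurableSet_Ioi (a := (0 : ℝ)))).2 hg
  set F := (Set.Ioi (0 : ℝ)).indicator f
  set G := (Set.Ioi (0 : ℝ)).indicator g
  have hint := hF.convolution_integrand (ContinuousLinearMap.mul ℝ ℂ) hG (μ := volume) (ν := volume)
  have ind : ∀ (φ : ℝ → ℂ) (y : X), (∫ s in Set.Ioi 0, φ s • S.real s y)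
      = ∫ s, (Set.Ioi (0 : ℝ)).indicator φ s • S.real s y := by
    intro φ y
    rw [← integral_indicator measurableSet_Ioi]
    congr 1
    ext s
    by_cases hs : s ∈ Set.Ioi (0 : ℝ) <;> simp [hs]
  rw [phillips_apply, phillips_apply, phillips_apply, ind k x, hpos, ind f]
  have e1 : ∀ u, (MeasureTheory.convolution F G (ContinuousLinearMap.mul ℝ ℂ) volume u) • S.real u x
      = ∫ t, (F t * G (u - t)) • S.real u x := by
    intro u
    rw [integral_smul_const]
    rfl
  simp_rw [e1]
  rw [integral_integral_swap]
  · congr 1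
    ext t
    by_cases ht : 0 < t
    · simp_rw [mul_smul]
      rw [integral_smul, ind g x,
        ← (S.real t).integral_comp_comm (integrable_smul_real hM hG x),
        ← integral_add_right_eq_self (fun u => G (u - t) • S.real u x) t]
      congr 2
      ext v
      by_cases hv : 0 < v
      · rw [map_smul, add_sub_cancel_right, add_comm v t, S.real_add ht.le hv.le]
      · simp [G, hv]
    · simp [F, ht]
  · refine (hint.norm.mul_const (M * ‖x‖)).mono' (hint.aestronglyMeasurable.smul
      ((continuous_real hM x).comp continuous_fst).aestronglyMeasurable)
      (Eventually.of_forall fun s => ?_)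
    simp only [Function.uncurry]
    rw [norm_smul]
    gcongr
    · simp
    · exact norm_real_le hM _ x

end C0Semigroup

end SemigroupWeiss

end

/-! ### Gamma kernels -/

noncomputable section

namespace SemigroupWeiss

variable {X : Type*} [NormedAddCommGroup X] [NormedSpace ℂ X]

/-- The kernel `s^(a-1) e^(-z s) / Γ(a)`, whose Laplace transform at `w` is `(z + w)^(-a)`. -/
def gammaKernel (a : ℝ) (z : ℂ) (s : ℝ) : ℂ :=
  ((s ^ (a - 1) / Real.Gamma a : ℝ) : ℂ) * Complex.exp (-(z * s))

theorem norm_gammaKernel {a : ℝ} (ha : 0 < a) (z : ℂ) {s : ℝ} (hs : 0 ≤ s) :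
    ‖gammaKernel a z s‖ = s ^ (a - 1) * Real.exp (-(z.re * s)) / Real.Gamma a := by
  have := Real.Gamma_pos_of_pos ha
  rw [gammaKernel, norm_mul, Complex.norm_exp, Complex.norm_real, Real.norm_of_nonneg (by positivity)]
  simp
  ring

theorem integrableOn_rpow_mul_exp {a r : ℝ} (ha : 0 < a) (hr : 0 < r) :
    IntegrableOn (fun s : ℝ => s ^ (a - 1) * Real.exp (-(r * s))) (Set.Ioi 0) := by
  have := integrableOn_rpow_mul_exp_neg_mul_rpow (p := 1) (s := a - 1) (b := r) (by linarith)
    one_pos hr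
  simpa using this

theorem measurable_gammaKernel (a : ℝ) (z : ℂ) : Measurable (gammaKernel a z) := by
  unfold gammaKernel
  fun_prop

theorem integrableOn_gammaKernel {a : ℝ} {z : ℂ} (ha : 0 < a) (hz : 0 < z.re) :
    IntegrableOn (gammaKernel a z) (Set.Ioi 0) := by
  refine ((integrableOn_rpow_mul_exp ha hz).div_const (Real.Gamma a)).mono'
    (measurable_gammaKernel a z).aestronglyMeasurable ?_
  refine (ae_restrict_iff' measurableSet_Ioi).2 (Eventually.of_forall fun s hs => ?_)
  exact (norm_gammaKernel ha z (le_of_lt hs)).le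

theorem integral_norm_gammaKernel {a : ℝ} {z : ℂ} (ha : 0 < a) (hz : 0 < z.re) :
    ∫ s in Set.Ioi 0, ‖gammaKernel a z s‖ = (1 / z.re) ^ a := by
  rw [setIntegral_congr_fun measurableSet_Ioi
    (fun s hs => norm_gammaKernel ha z (le_of_lt hs)), integral_div,
    Real.integral_rpow_mul_exp_neg_mul_Ioi ha hz]
  have := Real.Gamma_pos_of_pos ha
  field_simp

/-- The exponentials multiply to e^(-zu), and what remains is Euler's Beta integral B(a, b). This is
the law of exponents for negative powers of zI - A. -/
theorem gammaKernel_convolution {a b : ℝ} (z : ℂ) (ha : 0 < a) (hb : 0 < b) {u : ℝ} (hu : 0 < u) :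
    ∫ t in (0)..u, gammaKernel a z t * gammaKernel b z (u - t) = gammaKernel (a + b) z u := by
  have hGa := (Real.Gamma_pos_of_pos ha).ne'
  have hGb := (Real.Gamma_pos_of_pos hb).ne'
  have hGab := (Real.Gamma_pos_of_pos (add_pos ha hb)).ne'
  have e : ∀ t ∈ Set.uIcc 0 u, gammaKernel a z t * gammaKernel b z (u - t) =
      (Complex.exp (-(z * u)) / (Real.Gamma a * Real.Gamma b)) *
        ((t : ℂ) ^ ((a : ℂ) - 1) * ((u : ℂ) - t) ^ ((b : ℂ) - 1)) := by
    intro t ht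
    rw [Set.uIcc_of_le hu.le] at ht
    have h1 : Complex.exp (-(z * u)) =
        Complex.exp (-(z * t)) * Complex.exp (-(z * (u - t : ℝ))) := by
      rw [← Complex.exp_add]; congr 1; push_cast; ring
    have h2 : ((t ^ (a - 1) : ℝ) : ℂ) = (t : ℂ) ^ ((a : ℂ) - 1) := by
      rw [Complex.ofReal_cpow ht.1]; push_cast; rfl
    have h3 : (((u - t) ^ (b - 1) : ℝ) : ℂ) = ((u : ℂ) - t) ^ ((b : ℂ) - 1) := by
      rw [Complex.ofReal_cpow (by linarith [ht.2])]; push_cast; rfl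
    rw [gammaKernel, gammaKernel, h1, ← h2, ← h3]
    push_cast
    ring
  rw [intervalIntegral.integral_congr e, intervalIntegral.integral_const_mul,
    Complex.betaIntegral_scaled _ _ hu, Complex.betaIntegral_eq_Gamma_mul_div _ _ (by simpa)
      (by simpa), gammaKernel, ← Complex.ofReal_add, Complex.Gamma_ofReal, Complex.Gamma_ofReal,
    Complex.Gamma_ofReal, Complex.ofReal_div, Complex.ofReal_cpow hu.le]
  have := Complex.ofReal_ne_zero.2 hGa
  have := Complex.ofReal_ne_zero.2 hGb
  have := Complex.ofReal_ne_zero.2 hGab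
  push_cast
  field_simp

/-! ### The resolvent as Laplace transform, and negative powers of zI - A -/

/-- Bounded inverses of `z I - A` are unique. -/
theorem IsResolventAt.unique {A : X →ₗ.[ℂ] X} {z : ℂ} {R R' : X →L[ℂ] X}
    (h : IsResolventAt A z R) (h' : IsResolventAt A z R') : R = R' := by
  ext x
  obtain ⟨hx, e⟩ := h.1 x
  refine (h'.2 ⟨R x, hx⟩).symm.trans (congrArg R' e)

theorem isResolventAt_resolventOp {A : X →ₗ.[ℂ] X} {z : ℂ} (h : z ∈ resolventSet A) :
    IsResolventAt A z (resolventOp A z) := by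
  have h' : ∃ R, IsResolventAt A z R := h
  rw [resolventOp, dif_pos h']
  exact h'.choose_spec

/-- The resolvent identity. -/
theorem resolventOp_sub {A : X →ₗ.[ℂ] X} {z w : ℂ} (hz : z ∈ resolventSet A)
    (hw : w ∈ resolventSet A) :
    resolventOp A z - resolventOp A w = (w - z) • (resolventOp A w * resolventOp A z) := by
  ext x
  obtain ⟨h, e⟩ := (isResolventAt_resolventOp hz).1 x
  have e2 := (isResolventAt_resolventOp hw).2 ⟨_, h⟩
  rw [sub_eq_iff_eq_add] at e
  have e3 : A ⟨resolventOp A z x, h⟩ = z • resolventOp A z x - x := by rw [eq_sub_iff_add_eq', e]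
  rw [e3] at e2
  simp only [map_sub, map_smul] at e2
  simp only [sub_apply, smul_apply, mul_apply_eq_comp]
  rw [sub_smul, sub_eq_iff_eq_add]
  nth_rewrite 1 [← e2]
  abel

namespace C0Semigroup

variable {S : C0Semigroup X}

/-- `S.HasDerivZero x y` means `x ∈ D(A)` and `A x = y`. -/
theorem generator_apply {x y : X} (h : S.HasDerivZero x y) :
    S.generator ⟨x, y, h⟩ = y :=
  HasDerivZero.unique (Exists.choose_spec (⟨y, h⟩ : ∃ y, S.HasDerivZero x y)) h

theorem hasDerivZero_generator (x : S.generator.domain) : S.HasDerivZero x (S.generator x) :=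
  Exists.choose_spec x.2

theorem hasDerivZero_of_commute {L : X →L[ℂ] X} (hL : ∀ t, Commute L (S.T t)) {x y : X}
    (h : S.HasDerivZero x y) : S.HasDerivZero (L x) (L y) := by
  refine ((L.continuous.tendsto y).comp h).congr fun s => ?_
  have e : L (S.T s x) = S.T s (L x) := congrArg (fun P : X →L[ℂ] X => P x) (hL s)
  simp only [Function.comp_apply, map_smul, map_sub, e]

/-- The operator `(z I - A)^(-a)` for `a > 0` and `Re z > 0`. -/
def shiftPow (S : C0Semigroup X) (hS : S.IsBounded) {a : ℝ} {z : ℂ} (ha : 0 < a) (hz : 0 < z.re) :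
    X →L[ℂ] X :=
  S.phillips hS (gammaKernel a z) (integrableOn_gammaKernel ha hz)

variable [CompleteSpace X] (hS : S.IsBounded) {M : ℝ} (hM : ∀ t, ‖S.T t‖ ≤ M)

theorem shiftPow_mul {a b : ℝ} {z : ℂ} (ha : 0 < a) (hb : 0 < b) (hz : 0 < z.re) :
    S.shiftPow hS ha hz * S.shiftPow hS hb hz = S.shiftPow hS (add_pos ha hb) hz :=
  phillips_mul hS _ _ _ fun _ hu => gammaKernel_convolution z ha hb hu

theorem commute_shiftPow {a : ℝ} {z : ℂ} (ha : 0 < a) (hz : 0 < z.re) {L : X →L[ℂ] X}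
    (hL : ∀ t, Commute L (S.T t)) : Commute L (S.shiftPow hS ha hz) :=
  commute_phillips hS _ hL

omit [CompleteSpace X] in
include hM in
theorem norm_shiftPow_le {a : ℝ} {z : ℂ} (ha : 0 < a) (hz : 0 < z.re) :
    ‖S.shiftPow hS ha hz‖ ≤ (1 / z.re) ^ a * M := by
  refine ContinuousLinearMap.opNorm_le_bound _ (mul_nonneg (by positivity) (bound_nonneg hM))
    fun x => ?_
  rw [← integral_norm_gammaKernel ha hz]
  exact norm_integral_smul_real_le hM (integrableOn_gammaKernel ha hz) x

omit [CompleteSpace X] in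
theorem shiftPow_one_apply {z : ℂ} (hz : 0 < z.re) (x : X) :
    S.shiftPow hS one_pos hz x = ∫ s in Set.Ioi (0 : ℝ), Complex.exp (-(z * s)) • S.real s x := by
  simp [shiftPow, phillips_apply, gammaKernel]

/-- Shifting the Laplace integral gives T(h)J = e^(zh) (J - ∫₀^h e^(-zs) T(s)x ds), which is
differentiated at h = 0 by the product rule. -/
theorem hasDerivZero_shiftPow_one {z : ℂ} (hz : 0 < z.re) (x : X) :
    S.HasDerivZero (S.shiftPow hS one_pos hz x) (z • S.shiftPow hS one_pos hz x - x) := by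
  obtain ⟨M, hM⟩ := id hS
  set J := S.shiftPow hS one_pos hz x with hJ
  set f : ℝ → X := fun s => Complex.exp (-(z * s)) • S.real s x with hf
  have hJf : J = ∫ s in Set.Ioi 0, f s := shiftPow_one_apply hS hz x
  have hexp : IntegrableOn (fun s : ℝ => Complex.exp (-(z * s))) (Set.Ioi 0) := by
    refine (integrableOn_gammaKernel one_pos hz).congr_fun (fun s _ => ?_) measurableSet_Ioi
    simp [gammaKernel]
  have hfi : IntegrableOn f (Set.Ioi 0) := integrable_smul_real hM hexp x
  have hfc : Continuous f := by
    have := continuous_real hM x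
    fun_prop
  have hT : ∀ h : ℝ≥0, S.T h J = Complex.exp (z * h) • (J - ∫ s in (0)..(h : ℝ), f s) := by
    intro h
    have e1 : J - ∫ s in (0)..(h : ℝ), f s = ∫ s in Set.Ioi (h : ℝ), f s := by
      rw [hJf, sub_eq_iff_eq_add',
        intervalIntegral.integral_interval_add_Ioi hfi (hfi.mono_set (Set.Ioi_subset_Ioi h.coe_nonneg))]
    rw [e1, ← integral_smul, hJf, ← ContinuousLinearMap.integral_comp_comm _ hfi]
    have e2 := (measurePreserving_add_right volume (h : ℝ)).setIntegral_preimage_emb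
      (measurableEmbedding_addRight (h : ℝ)) (fun s => Complex.exp (z * h) • f s) (Set.Ioi (h : ℝ))
    rw [Set.preimage_add_const_Ioi, sub_self] at e2
    rw [← e2]
    refine setIntegral_congr_fun measurableSet_Ioi fun s hs => ?_
    simp only [hf]
    rw [map_smul, add_comm s, S.real_add h.coe_nonneg (le_of_lt hs), real_coe, smul_smul, ← Complex.exp_add]
    congr 2
    push_cast
    ring
  have hd : HasDerivAt (fun h : ℝ => Complex.exp (z * h) • (J - ∫ s in (0)..h, f s))
      (z • J - x) 0 := by
    have h1 : HasDerivAt (fun h : ℝ => Complex.exp (z * h)) z 0 := by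
      have : HasDerivAt (fun h : ℝ => z * (h : ℂ)) (z * 1) 0 :=
        ((hasDerivAt_id (0 : ℝ)).ofReal_comp).const_mul z
      simpa using! this.cexp
    -- The constant extension of the semigroup to s < 0 keeps `f` continuous on ℝ, so the two-sided
    -- derivative at 0 exists.
    have h2 : HasDerivAt (fun h : ℝ => ∫ s in (0)..h, f s) (f 0) 0 :=
      intervalIntegral.integral_hasDerivAt_right (hfc.intervalIntegrable _ _)
        hfc.stronglyMeasurable.stronglyMeasurableAtFilter hfc.continuousAt
    have h3 := h1.smul (h2.const_sub J)
    have hf0 : f 0 = x := by simp [hf, real, S.map_zero']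
    simpa [hf0, neg_add_eq_sub] using! h3
  have ht : Tendsto (fun t : ℝ≥0 => (t : ℝ)) (𝓝[>] 0) (𝓝[≠] 0) := by
    refine tendsto_nhdsWithin_iff.2 ⟨?_, ?_⟩
    · exact (NNReal.continuous_coe.tendsto' 0 0 rfl).mono_left nhdsWithin_le_nhds
    · filter_upwards [self_mem_nhdsWithin] with t ht
      exact (NNReal.coe_pos.2 ht).ne'
  refine ((hasDerivAt_iff_tendsto_slope.1 hd).comp ht).congr fun t => ?_
  simp only [Function.comp_apply, slope, vsub_eq_sub, hT]
  simp [← Complex.ofReal_inv, Complex.coe_smul]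

theorem isResolventAt_shiftPow_one {z : ℂ} (hz : 0 < z.re) :
    IsResolventAt S.generator z (S.shiftPow hS one_pos hz) := by
  refine ⟨fun x => ?_, fun x => ?_⟩
  · refine ⟨⟨_, hasDerivZero_shiftPow_one hS hz x⟩, ?_⟩
    rw [generator_apply (hasDerivZero_shiftPow_one hS hz x)]
    abel
  -- For x in D(A) the derivative at 0 is computed twice: once by the previous lemma, once as J(Ax),
  -- because J commutes with the semigroup.
  · have h1 := hasDerivZero_shiftPow_one hS hz x
    have h2 := hasDerivZero_of_commute (L := S.shiftPow hS one_pos hz)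
      (fun t => (commute_shiftPow hS one_pos hz (S.commute_T t)).symm) (hasDerivZero_generator x)
    rw [map_sub, map_smul, ← h1.unique h2]
    abel

include hS in
theorem mem_resolventSet {z : ℂ} (hz : 0 < z.re) : z ∈ resolventSet S.generator :=
  ⟨_, isResolventAt_shiftPow_one hS hz⟩

theorem resolventOp_eq {z : ℂ} (hz : 0 < z.re) :
    resolventOp S.generator z = S.shiftPow hS one_pos hz :=
  (isResolventAt_resolventOp (mem_resolventSet hS hz)).unique (isResolventAt_shiftPow_one hS hz)

theorem resolventOp_pow_eq {z : ℂ} (hz : 0 < z.re) {n : ℕ} (hn : 0 < n) :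
    resolventOp S.generator z ^ n = S.shiftPow hS (Nat.cast_pos.2 hn) hz := by
  induction n, hn using Nat.le_induction with
  | base => simp [resolventOp_eq hS hz]
  | succ n hn ih =>
    rw [pow_succ, ih, resolventOp_eq hS hz, shiftPow_mul hS]
    congr 1
    simp

end C0Semigroup

end SemigroupWeiss

end

/-! ### Integrals of t^(δ-1) G(t) with separate bounds near 0 and near infinity -/

noncomputable section

namespace SemigroupWeiss

section Dominated

variable {E : Type*} [NormedAddCommGroup E] [NormedSpace ℂ E]

/-- A dominating function for `t^(δ-1) G(t)` when `‖G(t)‖ ≤ a` and `‖G(t)‖ ≤ b t^(-p)`. -/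
def powBound (δ p a b s t : ℝ) : ℝ :=
  if t ≤ s then a * t ^ (δ - 1) else b * t ^ (δ - p - 1)

variable {δ p a b s : ℝ}

theorem norm_rpow_smul_le {G : ℝ → E} (ha : ∀ t, 0 < t → ‖G t‖ ≤ a)
    (hb : ∀ t, 0 < t → ‖G t‖ ≤ b * t ^ (-p)) {t : ℝ} (ht : 0 < t) :
    ‖((t ^ (δ - 1) : ℝ) : ℂ) • G t‖ ≤ powBound δ p a b s t := by
  rw [norm_smul, Complex.norm_real, Real.norm_of_nonneg (by positivity), powBound]
  split_ifs
  · rw [mul_comm]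
    gcongr
    exact ha t ht
  · calc _ ≤ t ^ (δ - 1) * (b * t ^ (-p)) := by gcongr; exact hb t ht
      _ = b * t ^ (δ - p - 1) := by
        rw [mul_left_comm, ← Real.rpow_add ht]; congr 2; ring

theorem hasIntegral_powBound (hδ : 0 < δ) (hp : δ < p) (hs : 0 < s) :
    IntegrableOn (powBound δ p a b s) (Set.Ioi 0) ∧
      ∫ t in Set.Ioi 0, powBound δ p a b s t = a * (s ^ δ / δ) + b * (s ^ (δ - p) / (p - δ)) := by
  have e1 : Set.EqOn (fun t => a * t ^ (δ - 1)) (powBound δ p a b s) (Set.Ioc 0 s) :=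
    fun t ht => (if_pos ht.2).symm
  have e2 : Set.EqOn (fun t => b * t ^ (δ - p - 1)) (powBound δ p a b s) (Set.Ioi s) :=
    fun t ht => (if_neg (not_le.2 ht)).symm
  have i1 : IntegrableOn (powBound δ p a b s) (Set.Ioc 0 s) := by
    refine IntegrableOn.congr_fun ?_ e1 measurableSet_Ioc
    exact (intervalIntegrable_iff_integrableOn_Ioc_of_le hs.le).1
      ((intervalIntegral.intervalIntegrable_rpow' (by linarith)).const_mul a)
  have i2 : IntegrableOn (powBound δ p a b s) (Set.Ioi s) := by
    refine IntegrableOn.congr_fun ?_ e2 measurableSet_Ioi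
    exact (integrableOn_Ioi_rpow_of_lt (by linarith) hs).const_mul b
  rw [← Set.Ioc_union_Ioi_eq_Ioi hs.le]
  refine ⟨i1.union i2, ?_⟩
  rw [setIntegral_union Set.Ioc_disjoint_Ioi_same measurableSet_Ioi i1 i2,
    ← setIntegral_congr_fun measurableSet_Ioc e1, ← setIntegral_congr_fun measurableSet_Ioi e2,
    integral_const_mul, integral_const_mul, ← intervalIntegral.integral_of_le hs.le,
    integral_rpow (Or.inl (by linarith)), integral_Ioi_rpow_of_lt (by linarith) hs]
  have h1 : p - δ ≠ 0 := by linarith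
  have h2 : δ - p ≠ 0 := by linarith
  simp only [sub_add_cancel, Real.zero_rpow hδ.ne', sub_zero]
  congr 2
  rw [neg_div, ← div_neg, neg_sub]

variable {G : ℝ → E} (hδ : 0 < δ) (hp : δ < p)
include hδ hp

theorem integrableOn_rpow_smul (hG : ContinuousOn G (Set.Ioi 0))
    (ha : ∀ t, 0 < t → ‖G t‖ ≤ a) (hb : ∀ t, 0 < t → ‖G t‖ ≤ b * t ^ (-p)) :
    IntegrableOn (fun t : ℝ => ((t ^ (δ - 1) : ℝ) : ℂ) • G t) (Set.Ioi 0) := by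
  refine (hasIntegral_powBound (a := a) (b := b) hδ hp one_pos).1.mono' ?_
    ((ae_restrict_iff' measurableSet_Ioi).2
      (Eventually.of_forall fun t ht => norm_rpow_smul_le ha hb ht))
  refine AEStronglyMeasurable.smul ?_ (hG.aestronglyMeasurable measurableSet_Ioi)
  exact (by fun_prop : Measurable fun t : ℝ => ((t ^ (δ - 1) : ℝ) : ℂ)).aestronglyMeasurable

/-- The splitting point s is left free; choosing it to balance the two terms is what produces the
scaling and interpolation estimates. -/
theorem norm_integral_rpow_smul_le (hs : 0 < s)
    (ha : ∀ t, 0 < t → ‖G t‖ ≤ a) (hb : ∀ t, 0 < t → ‖G t‖ ≤ b * t ^ (-p)) :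
    ‖∫ t in Set.Ioi (0 : ℝ), ((t ^ (δ - 1) : ℝ) : ℂ) • G t‖ ≤
      a * (s ^ δ / δ) + b * (s ^ (δ - p) / (p - δ)) := by
  obtain ⟨hi, e⟩ := hasIntegral_powBound (a := a) (b := b) hδ hp hs
  rw [← e]
  exact norm_integral_le_of_norm_le hi ((ae_restrict_iff' measurableSet_Ioi).2
      (Eventually.of_forall fun t ht => norm_rpow_smul_le ha hb ht))

theorem tendsto_integral_rpow_smul {F : ℕ → ℝ → E} (hF : ∀ k, ContinuousOn (F k) (Set.Ioi 0))
    (ha : ∀ k t, 0 < t → ‖F k t‖ ≤ a) (hb : ∀ k t, 0 < t → ‖F k t‖ ≤ b * t ^ (-p))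
    (hlim : ∀ t, 0 < t → Tendsto (fun k => F k t) atTop (𝓝 (G t))) :
    Tendsto (fun k => ∫ t in Set.Ioi (0 : ℝ), ((t ^ (δ - 1) : ℝ) : ℂ) • F k t) atTop
      (𝓝 (∫ t in Set.Ioi (0 : ℝ), ((t ^ (δ - 1) : ℝ) : ℂ) • G t)) := by
  refine tendsto_integral_of_dominated_convergence (powBound δ p a b 1)
    (fun k => (integrableOn_rpow_smul hδ hp (hF k) (ha k) (hb k)).aestronglyMeasurable)
    (hasIntegral_powBound hδ hp one_pos).1 (fun k => ?_) ?_
  · exact (ae_restrict_iff' measurableSet_Ioi).2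
      (Eventually.of_forall fun t ht => norm_rpow_smul_le (ha k) (hb k) ht)
  · exact (ae_restrict_iff' measurableSet_Ioi).2
      (Eventually.of_forall fun t ht => (hlim t ht).const_smul _)

end Dominated

/-! ### The operators R(t, A) and -A R(t, A) -/

variable {X : Type*} [NormedAddCommGroup X] [NormedSpace ℂ X]

namespace C0Semigroup

variable {S : C0Semigroup X}

/-- The resolvent `R(t, A)` for real `t`. -/
def res (S : C0Semigroup X) (t : ℝ) : X →L[ℂ] X := resolventOp S.generator t

/-- The operator `-A R(t, A) = I - t R(t, A)` for real `t`. -/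
def negRes (S : C0Semigroup X) (t : ℝ) : X →L[ℂ] X := 1 - (t : ℂ) • S.res t

variable [CompleteSpace X] (hS : S.IsBounded) {M : ℝ} (hM : ∀ t, ‖S.T t‖ ≤ M)

section
include hS

theorem commute_resolventOp {z : ℂ} (hz : 0 < z.re) {L : X →L[ℂ] X}
    (hL : ∀ t, Commute L (S.T t)) : Commute L (resolventOp S.generator z) := by
  rw [resolventOp_eq hS hz]
  exact commute_shiftPow hS one_pos hz hL

theorem commute_res {t : ℝ} (ht : 0 < t) {L : X →L[ℂ] X} (hL : ∀ t, Commute L (S.T t)) :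
    Commute L (S.res t) := commute_resolventOp hS (by simpa) hL

theorem commute_negRes {t : ℝ} (ht : 0 < t) {L : X →L[ℂ] X} (hL : ∀ t, Commute L (S.T t)) :
    Commute L (S.negRes t) :=
  (Commute.one_right L).sub_right ((commute_res hS ht hL).smul_right _)

theorem res_commute_T {t : ℝ} (ht : 0 < t) (s : ℝ≥0) : Commute (S.res t) (S.T s) :=
  (commute_res hS ht (S.commute_T s)).symm

theorem negRes_commute_T {t : ℝ} (ht : 0 < t) (s : ℝ≥0) : Commute (S.negRes t) (S.T s) :=
  (commute_negRes hS ht (S.commute_T s)).symm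

/-- Both sides are -A R(t, A) R(s, A). Letting -A fall on either resolvent leaves decay in the
parameter of the other one. -/
theorem res_mul_negRes {s t : ℝ} (hs : 0 < s) (ht : 0 < t) :
    S.res t * S.negRes s = S.negRes t * S.res s := by
  have h := resolventOp_sub (mem_resolventSet hS (z := s) (by simpa))
    (mem_resolventSet hS (z := t) (by simpa))
  have hc : S.res s * S.res t = S.res t * S.res s := (commute_res hS ht (res_commute_T hS hs)).eq
  change S.res s - S.res t = ((t : ℂ) - s) • (S.res t * S.res s) at h
  simp only [negRes, mul_sub, sub_mul, mul_one, one_mul, mul_smul_comm, smul_mul_assoc]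
  rw [sub_smul] at h
  rw [sub_eq_sub_iff_add_eq_add]
  rw [sub_eq_sub_iff_add_eq_add] at h
  rw [add_comm, add_comm (S.res s)] at *
  rw [add_comm _ (S.res s), ← h, add_comm]

include hM

theorem norm_res_pow_le {t : ℝ} (ht : 0 < t) {n : ℕ} (hn : 0 < n) :
    ‖S.res t ^ n‖ ≤ M * t ^ (-(n : ℝ)) := by
  have hz : 0 < ((t : ℂ)).re := by simpa
  rw [res, resolventOp_pow_eq hS hz hn]
  refine (norm_shiftPow_le hS hM _ hz).trans_eq ?_
  rw [mul_comm, Complex.ofReal_re, one_div, Real.inv_rpow ht.le, Real.rpow_neg ht.le]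

theorem norm_res_le {t : ℝ} (ht : 0 < t) : ‖S.res t‖ ≤ M / t := by
  simpa [Real.rpow_neg_one, div_eq_mul_inv] using norm_res_pow_le hS hM ht one_pos

theorem norm_negRes_le {t : ℝ} (ht : 0 < t) : ‖S.negRes t‖ ≤ 1 + M := by
  have h1 : ‖(1 : X →L[ℂ] X)‖ ≤ 1 := ContinuousLinearMap.norm_id_le
  calc _ ≤ ‖(1 : X →L[ℂ] X)‖ + ‖(t : ℂ) • S.res t‖ := norm_sub_le _ _
    _ ≤ 1 + M := by
      rw [norm_smul, Complex.norm_real, Real.norm_of_nonneg ht.le]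
      have := norm_res_le hS hM ht
      rw [le_div_iff₀ ht] at this
      linarith

theorem norm_res_mul_negRes_pow_le {s t : ℝ} (hs : 0 < s) (ht : 0 < t) (n : ℕ) :
    ‖(S.res t * S.negRes s) ^ n‖ ≤ (M * (1 + M)) ^ n * s ^ (-(n : ℝ)) ∧
    ‖(S.res t * S.negRes s) ^ n‖ ≤ (M * (1 + M)) ^ n * t ^ (-(n : ℝ)) := by
  have hM0 := bound_nonneg hM
  have key : ∀ r : ℝ, 0 < r → ‖S.res t * S.negRes s‖ ≤ M * (1 + M) / r →
      ‖(S.res t * S.negRes s) ^ n‖ ≤ (M * (1 + M)) ^ n * r ^ (-(n : ℝ)) := by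
    intro r hr h
    rw [Real.rpow_neg hr.le, Real.rpow_natCast, ← div_eq_mul_inv, ← div_pow]
    rcases Nat.eq_zero_or_pos n with rfl | hn
    · simpa using! (ContinuousLinearMap.norm_id_le (𝕜 := ℂ) (E := X))
    · exact (norm_pow_le' _ hn).trans (by gcongr)
  constructor
  · refine key s hs ?_
    rw [res_mul_negRes hS hs ht]
    calc _ ≤ ‖S.negRes t‖ * ‖S.res s‖ := norm_mul_le _ _
      _ ≤ (1 + M) * (M / s) := by
        gcongr
        exacts [norm_negRes_le hS hM ht, norm_res_le hS hM hs]
      _ = _ := by ring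
  · refine key t ht ?_
    calc _ ≤ ‖S.res t‖ * ‖S.negRes s‖ := norm_mul_le _ _
      _ ≤ (M / t) * (1 + M) := by
        gcongr
        exacts [norm_res_le hS hM ht, norm_negRes_le hS hM hs]
      _ = _ := by ring

omit hM in
theorem continuousOn_res : ContinuousOn S.res (Set.Ioi 0) := by
  obtain ⟨M, hM⟩ := id hS
  have hM0 := bound_nonneg hM
  intro s hs
  have hs : 0 < s := hs
  refine ContinuousAt.continuousWithinAt ?_
  rw [ContinuousAt, tendsto_iff_norm_sub_tendsto_zero]
  have hb : ContinuousAt (fun t : ℝ => |s - t| * (M / s * (M / t))) s := by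
    fun_prop (disch := exact hs.ne')
  have hb' := hb.tendsto
  simp only [sub_self, abs_zero, zero_mul] at hb'
  refine squeeze_zero' (Eventually.of_forall fun _ => norm_nonneg _) ?_ hb'
  filter_upwards [lt_mem_nhds hs] with t ht
  have h := resolventOp_sub (mem_resolventSet hS (z := t) (by simpa))
    (mem_resolventSet hS (z := s) (by simpa))
  rw [res, res, h, norm_smul, ← Complex.ofReal_sub, Complex.norm_real, Real.norm_eq_abs]
  gcongr
  refine (norm_mul_le _ _).trans ?_
  gcongr
  exacts [norm_res_le hS hM hs, norm_res_le hS hM ht]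

omit hM in
theorem continuousOn_negRes : ContinuousOn S.negRes (Set.Ioi 0) := by
  have := continuousOn_res hS
  unfold negRes
  fun_prop

omit hM in
/-- `(-A) R(ε, A) → I` on the range of `A`, as `ε → 0`. -/
theorem tendsto_negRes_mul_negRes {ε : ℕ → ℝ} (hε : ∀ k, 0 < ε k) (hε0 : Tendsto ε atTop (𝓝 0))
    {s : ℝ} (hs : 0 < s) :
    Tendsto (fun k => S.negRes (ε k) * S.negRes s) atTop (𝓝 (S.negRes s)) := by
  obtain ⟨M, hM⟩ := id hS
  have hM0 := bound_nonneg hM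
  rw [tendsto_iff_norm_sub_tendsto_zero]
  have hb : Tendsto (fun k => ε k * (M * (1 + M) / s)) atTop (𝓝 0) := by
    simpa using hε0.mul_const (M * (1 + M) / s)
  refine squeeze_zero (fun _ => norm_nonneg _) (fun k => ?_) hb
  -- The difference is -ε R(ε, A)(-A)R(s, A); with -A moved onto R(ε, A) the product stays bounded,
  -- so the norm is O(ε).
  have e : S.negRes (ε k) * S.negRes s - S.negRes s =
      -((ε k : ℂ) • (S.res (ε k) * S.negRes s)) := by
    nth_rewrite 1 [negRes]
    rw [sub_mul, one_mul, smul_mul_assoc]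
    abel
  rw [e, norm_neg, norm_smul, Complex.norm_real, Real.norm_of_nonneg (hε k).le]
  have := (norm_res_mul_negRes_pow_le hS hM hs (hε k) 1).1
  simp only [pow_one, Nat.cast_one, Real.rpow_neg_one, ← div_eq_mul_inv] at this
  have := (hε k).le
  gcongr

end

/-! ### Balakrishnan's formula for negative powers of εI - A -/

/-- The scalar form of Balakrishnan's formula, on the level of kernels. -/
theorem integral_rpow_mul_gammaKernel {δ ε a : ℝ} {n : ℕ} (hδ : 0 < δ) (ha : 0 < a)
    (hn : δ + a = n) {s : ℝ} (hs : 0 < s) :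
    (∫ t in Set.Ioi (0 : ℝ), ((t ^ (δ - 1) : ℝ) : ℂ) * gammaKernel n ((t + ε : ℝ) : ℂ) s) =
      ((Real.Gamma δ * Real.Gamma a / Real.Gamma n : ℝ) : ℂ) * gammaKernel a ε s := by
  have hGa := (Real.Gamma_pos_of_pos ha).ne'
  have e : ∀ t ∈ Set.Ioi (0 : ℝ), ((t ^ (δ - 1) : ℝ) : ℂ) * gammaKernel n ((t + ε : ℝ) : ℂ) s =
      ((s ^ ((n : ℝ) - 1) / Real.Gamma n * Real.exp (-(ε * s)) *
        (t ^ (δ - 1) * Real.exp (-(s * t))) : ℝ) : ℂ) := by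
    intro t ht
    have h1 : Complex.exp (-(((t + ε : ℝ) : ℂ) * s)) =
        (Real.exp (-(ε * s)) : ℂ) * (Real.exp (-(s * t)) : ℂ) := by
      rw [Complex.ofReal_exp, Complex.ofReal_exp, ← Complex.exp_add]
      congr 1; push_cast; ring
    rw [gammaKernel, h1]
    push_cast
    ring
  rw [setIntegral_congr_fun measurableSet_Ioi e, integral_complex_ofReal, integral_const_mul,
    Real.integral_rpow_mul_exp_neg_mul_Ioi hδ hs, gammaKernel]
  have h2 : Complex.exp (-((ε : ℂ) * s)) = (Real.exp (-(ε * s)) : ℂ) := by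
    rw [Complex.ofReal_exp]; push_cast; rfl
  have h3 : s ^ ((n : ℝ) - 1) = s ^ (a - 1) * s ^ δ := by
    rw [← Real.rpow_add hs, ← hn]; congr 1; ring
  rw [h2, h3, one_div, Real.inv_rpow hs.le, ← Complex.ofReal_mul, ← Complex.ofReal_mul]
  congr 1
  have := (Real.rpow_pos_of_pos hs δ).ne'
  field_simp

/-- Integrating in t first leaves a multiple of s^(a-1) e^(-εs): here a > 0 gives convergence at 0
and ε > 0 at infinity. -/
theorem integrable_rpow_mul_gammaKernel {δ ε a : ℝ} {n : ℕ} (hδ : 0 < δ) (ha : 0 < a)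
    (hε : 0 < ε) (hn : δ + a = n) :
    Integrable (fun q : ℝ × ℝ => ((q.1 ^ (δ - 1) : ℝ) : ℂ) *
      gammaKernel n ((q.1 + ε : ℝ) : ℂ) q.2)
      ((volume.restrict (Set.Ioi 0)).prod (volume.restrict (Set.Ioi 0))) := by
  have hn0 : (0 : ℝ) < n := by linarith
  have hmeas : Measurable fun q : ℝ × ℝ => ((q.1 ^ (δ - 1) : ℝ) : ℂ) *
      gammaKernel n ((q.1 + ε : ℝ) : ℂ) q.2 := by
    unfold gammaKernel
    fun_prop
  rw [integrable_prod_iff' hmeas.aestronglyMeasurable]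
  have e : ∀ s : ℝ, 0 < s → ∀ t ∈ Set.Ioi (0 : ℝ),
      ‖((t ^ (δ - 1) : ℝ) : ℂ) * gammaKernel n ((t + ε : ℝ) : ℂ) s‖ =
      s ^ ((n : ℝ) - 1) / Real.Gamma n * Real.exp (-(ε * s)) *
        (t ^ (δ - 1) * Real.exp (-(s * t))) := by
    intro s hs t ht
    have ht : 0 < t := ht
    rw [norm_mul, norm_gammaKernel hn0 _ hs.le, Complex.norm_real,
      Real.norm_of_nonneg (by positivity), Complex.ofReal_re,
      show -((t + ε) * s) = -(ε * s) + -(s * t) by ring, Real.exp_add]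
    ring
  constructor
  · refine (ae_restrict_iff' measurableSet_Ioi).2 (Eventually.of_forall fun s hs => ?_)
    have hm : AEStronglyMeasurable (fun t : ℝ => ((t ^ (δ - 1) : ℝ) : ℂ) *
      gammaKernel n ((t + ε : ℝ) : ℂ) s) (volume.restrict (Set.Ioi 0)) :=
      (hmeas.comp (measurable_id.prodMk measurable_const)).aestronglyMeasurable
    refine Integrable.mono' (((integrableOn_rpow_mul_exp hδ hs).const_mul
      (s ^ ((n : ℝ) - 1) / Real.Gamma n * Real.exp (-(ε * s))))) hm
      ((ae_restrict_iff' measurableSet_Ioi).2 (Eventually.of_forall fun t ht => ?_))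
    exact (e s hs t ht).le
  · have hi : IntegrableOn (fun s : ℝ => Real.Gamma δ / Real.Gamma n *
        (s ^ (a - 1) * Real.exp (-(ε * s)))) (Set.Ioi 0) :=
      (integrableOn_rpow_mul_exp ha hε).const_mul _
    refine hi.congr_fun (fun s hs => ?_) measurableSet_Ioi
    have hs : 0 < s := hs
    simp only
    rw [setIntegral_congr_fun measurableSet_Ioi (e s hs), integral_const_mul,
      Real.integral_rpow_mul_exp_neg_mul_Ioi hδ hs]
    have h3 : s ^ ((n : ℝ) - 1) = s ^ (a - 1) * s ^ δ := by
      rw [← Real.rpow_add hs, ← hn]; congr 1; ring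
    have := (Real.rpow_pos_of_pos hs δ).ne'
    rw [h3, one_div, Real.inv_rpow hs.le]
    field_simp

/-- Balakrishnan's formula for the negative powers of `ε I - A`. -/
theorem integral_rpow_smul_res_pow {δ ε a : ℝ} {n : ℕ} (hδ : 0 < δ) (ha : 0 < a)
    (hε : 0 < ((ε : ℂ)).re) (hn : δ + a = n) :
    (∫ t in Set.Ioi (0 : ℝ), ((t ^ (δ - 1) : ℝ) : ℂ) • S.res (t + ε) ^ n) =
      ((Real.Gamma δ * Real.Gamma a / Real.Gamma n : ℝ) : ℂ) • S.shiftPow hS ha hε := by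
  obtain ⟨M, hM⟩ := id hS
  have hM0 := bound_nonneg hM
  have hε' : 0 < ε := by simpa using hε
  have hn0 : 0 < n := by
    have : (0 : ℝ) < n := by linarith
    exact_mod_cast this
  have hp : δ < (n : ℝ) := by linarith
  have hcont : ContinuousOn (fun t => S.res (t + ε) ^ n) (Set.Ioi 0) := by
    refine ContinuousOn.pow ?_ n
    refine (continuousOn_res hS).comp (by fun_prop) fun t ht => ?_
    have ht : 0 < t := ht
    change 0 < t + ε
    linarith
  -- Used with r = ε for t near 0 and with r = t for large t.
  have hbd : ∀ t : ℝ, 0 < t → ∀ r : ℝ, 0 < r → r ≤ t + ε →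
      ‖S.res (t + ε) ^ n‖ ≤ M * r ^ (-(n : ℝ)) := by
    intro t ht r hr hrt
    refine (norm_res_pow_le hS hM (by linarith) hn0).trans ?_
    gcongr ?_ * ?_
    exact Real.rpow_le_rpow_of_nonpos hr hrt (by simp)
  have hint := integrableOn_rpow_smul hδ hp hcont
    (fun t ht => hbd t ht ε hε' (by linarith)) (fun t ht => hbd t ht t ht (by linarith))
  ext x
  rw [ContinuousLinearMap.integral_apply hint]
  have e : ∀ t ∈ Set.Ioi (0 : ℝ), (((t ^ (δ - 1) : ℝ) : ℂ) • S.res (t + ε) ^ n) x =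
      ∫ s in Set.Ioi (0 : ℝ),
        (((t ^ (δ - 1) : ℝ) : ℂ) * gammaKernel n ((t + ε : ℝ) : ℂ) s) • S.real s x := by
    intro t ht
    have ht : 0 < t := ht
    have hz : 0 < (((t + ε : ℝ) : ℂ)).re := by rw [Complex.ofReal_re]; linarith
    rw [smul_apply, res, resolventOp_pow_eq hS hz hn0, shiftPow, phillips_apply,
      ← integral_smul]
    simp only [smul_smul]
  rw [setIntegral_congr_fun measurableSet_Ioi e, integral_integral_swap, smul_apply, shiftPow,
    phillips_apply, ← integral_smul]
  · refine setIntegral_congr_fun measurableSet_Ioi fun s hs => ?_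
    rw [integral_smul_const, integral_rpow_mul_gammaKernel hδ ha hn hs, mul_smul]
  · have hk := integrable_rpow_mul_gammaKernel hδ ha hε' hn
    refine (hk.norm.mul_const (M * ‖x‖)).mono' (hk.aestronglyMeasurable.smul
      ((continuous_real hM x).comp continuous_snd).aestronglyMeasurable)
      (Eventually.of_forall fun q => ?_)
    simp only [Function.uncurry]
    rw [norm_smul]
    gcongr
    exact norm_real_le hM _ x

end C0Semigroup

end SemigroupWeiss

end

/-! ### The bounded operators (-A)^δ (s - A)^(-n) -/

noncomputable section

namespace SemigroupWeiss

variable {X : Type*} [NormedAddCommGroup X] [NormedSpace ℂ X]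

namespace C0Semigroup

variable {S : C0Semigroup X}

/-- The bounded operator `(-A)^δ (s - A)^(-n)`, `0 < δ < n`. -/
def balak (S : C0Semigroup X) (δ : ℝ) (n : ℕ) (s : ℝ) : X →L[ℂ] X :=
  ((Real.Gamma n / (Real.Gamma δ * Real.Gamma (n - δ)) : ℝ) : ℂ) •
    ∫ t in Set.Ioi (0 : ℝ), ((t ^ (δ - 1) : ℝ) : ℂ) • (S.negRes t ^ n * S.res s ^ n)

theorem balakrishnan_eq (δ : ℝ) (n : ℕ) : balakrishnan S.generator δ n = S.balak δ n 1 := by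
  simp only [balak, balakrishnan, negRes, res, Complex.ofReal_one]

variable [CompleteSpace X] (hS : S.IsBounded) {M : ℝ} (hM : ∀ t, ‖S.T t‖ ≤ M)

section
include hS

theorem negRes_pow_mul_res_pow {s t : ℝ} (hs : 0 < s) (ht : 0 < t) (n : ℕ) :
    S.negRes t ^ n * S.res s ^ n = (S.res t * S.negRes s) ^ n := by
  rw [res_mul_negRes hS hs ht, Commute.mul_pow]
  exact commute_res hS hs (negRes_commute_T hS ht)

theorem continuousOn_negRes_pow_mul_res_pow (n : ℕ) (s : ℝ) :
    ContinuousOn (fun t => S.negRes t ^ n * S.res s ^ n) (Set.Ioi 0) :=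
  ((continuousOn_negRes hS).pow n).mul continuousOn_const

include hM in
theorem norm_negRes_pow_mul_res_pow_le {s t : ℝ} (hs : 0 < s) (ht : 0 < t) (n : ℕ) :
    ‖S.negRes t ^ n * S.res s ^ n‖ ≤ (M * (1 + M)) ^ n * s ^ (-(n : ℝ)) ∧
    ‖S.negRes t ^ n * S.res s ^ n‖ ≤ (M * (1 + M)) ^ n * t ^ (-(n : ℝ)) := by
  rw [negRes_pow_mul_res_pow hS hs ht]
  exact norm_res_mul_negRes_pow_le hS hM hs ht n

theorem integrableOn_balak {δ s : ℝ} {n : ℕ} (hδ : 0 < δ) (hn : δ < n) (hs : 0 < s) :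
    IntegrableOn (fun t : ℝ => ((t ^ (δ - 1) : ℝ) : ℂ) • (S.negRes t ^ n * S.res s ^ n))
      (Set.Ioi 0) := by
  obtain ⟨M, hM⟩ := id hS
  exact integrableOn_rpow_smul hδ hn (continuousOn_negRes_pow_mul_res_pow hS n s)
    (fun t ht => (norm_negRes_pow_mul_res_pow_le hS hM hs ht n).1)
    (fun t ht => (norm_negRes_pow_mul_res_pow_le hS hM hs ht n).2)

theorem balak_apply {δ s : ℝ} {n : ℕ} (hδ : 0 < δ) (hn : δ < n) (hs : 0 < s) (x : X) :
    S.balak δ n s x = ((Real.Gamma n / (Real.Gamma δ * Real.Gamma (n - δ)) : ℝ) : ℂ) •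
      ∫ t in Set.Ioi (0 : ℝ), ((t ^ (δ - 1) : ℝ) : ℂ) • (S.negRes t ^ n) ((S.res s ^ n) x) := by
  rw [balak, smul_apply, ContinuousLinearMap.integral_apply (integrableOn_balak hS hδ hn hs)]
  rfl

theorem commute_balak {δ s : ℝ} {n : ℕ} (hδ : 0 < δ) (hn : δ < n) (hs : 0 < s) {L : X →L[ℂ] X}
    (hL : ∀ t, Commute L (S.T t)) : Commute L (S.balak δ n s) := by
  have hi := integrableOn_balak hS hδ hn hs
  refine Commute.smul_right ?_ _
  rw [commute_iff_eq]
  have h1 := (ContinuousLinearMap.mul ℂ (X →L[ℂ] X) L).integral_comp_comm hi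
  have h2 := ((ContinuousLinearMap.mul ℂ (X →L[ℂ] X)).flip L).integral_comp_comm hi
  simp only [ContinuousLinearMap.mul_apply', ContinuousLinearMap.flip_apply] at h1 h2
  rw [← h1, ← h2]
  refine setIntegral_congr_fun measurableSet_Ioi fun t ht => ?_
  rw [mul_smul_comm, smul_mul_assoc]
  congr 1
  exact ((commute_negRes hS ht hL).pow_right n).mul_right ((commute_res hS hs hL).pow_right n)

/-- With the integral split at t = s, both parts scale like s^(δ-n). -/
theorem exists_norm_balak_le {δ : ℝ} {n : ℕ} (hδ : 0 < δ) (hn : δ < n) :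
    ∃ K : ℝ, 0 ≤ K ∧ ∀ s : ℝ, 0 < s → ‖S.balak δ n s‖ ≤ K * s ^ (δ - n) := by
  obtain ⟨M, hM⟩ := id hS
  have hM0 := bound_nonneg hM
  have hn' : 0 < n - δ := by linarith
  refine ⟨|Real.Gamma n / (Real.Gamma δ * Real.Gamma (n - δ))| *
    ((M * (1 + M)) ^ n * (1 / δ + 1 / (n - δ))), by positivity, fun s hs => ?_⟩
  have h := norm_integral_rpow_smul_le hδ hn hs
    (fun t ht => (norm_negRes_pow_mul_res_pow_le hS hM hs ht n).1)
    (fun t ht => (norm_negRes_pow_mul_res_pow_le hS hM hs ht n).2)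
  rw [balak, norm_smul, Complex.norm_real, Real.norm_eq_abs, mul_assoc]
  gcongr
  refine h.trans_eq ?_
  have e : s ^ (δ - n) = s ^ (-(n : ℝ)) * s ^ δ := by rw [← Real.rpow_add hs]; congr 1; ring
  rw [e]
  ring_nf

/-- `(-A)^δ (s - A)^(-n)` is the limit of `(ε - A)^(δ-n) [(-A) (s - A)⁻¹]^n`, and a further
factor `(-A) (ε - A)⁻¹` does not change this. -/
theorem tendsto_shiftPow_mul_negRes_pow {δ a s : ℝ} {n : ℕ} (hδ : 0 < δ) (ha : 0 < a)
    (hn : δ + a = n) (hs : 0 < s) {ε : ℕ → ℝ} (hε : ∀ k, 0 < ((ε k : ℝ) : ℂ).re)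
    (hε0 : Tendsto ε atTop (𝓝 0)) :
    Tendsto (fun k => S.shiftPow hS ha (hε k) * S.negRes s ^ n) atTop (𝓝 (S.balak δ n s)) ∧
    Tendsto (fun k => S.shiftPow hS ha (hε k) * S.negRes s ^ n * S.negRes (ε k)) atTop
      (𝓝 (S.balak δ n s)) := by
  obtain ⟨M, hM⟩ := id hS
  have hM0 := bound_nonneg hM
  have hε' : ∀ k, 0 < ε k := fun k => by simpa using hε k
  have hn' : δ < (n : ℝ) := by linarith
  have hG := Real.Gamma_pos_of_pos hδ
  have hG' := Real.Gamma_pos_of_pos ha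
  have hGn := Real.Gamma_pos_of_pos (hδ.trans hn')
  set c : ℂ := ((Real.Gamma n / (Real.Gamma δ * Real.Gamma (n - δ)) : ℝ) : ℂ) with hc
  -- Balakrishnan's formula for (ε-A)^(-a) carries the same constant as `balak`, so only the
  -- integrands have to converge: [R(t+ε, A)(-A)R(s, A)]^n tends to [-A R(t, A)]^n R(s, A)^n.
  have hJ : ∀ k, S.shiftPow hS ha (hε k) =
      c • ∫ t in Set.Ioi (0 : ℝ), ((t ^ (δ - 1) : ℝ) : ℂ) • S.res (t + ε k) ^ n := by
    intro k
    rw [integral_rpow_smul_res_pow hS hδ ha (hε k) hn, smul_smul, hc, ← Complex.ofReal_mul,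
      show (n : ℝ) - δ = a by linarith]
    have : Real.Gamma n / (Real.Gamma δ * Real.Gamma a) *
      (Real.Gamma δ * Real.Gamma a / Real.Gamma n) = 1 := by field_simp
    rw [this, Complex.ofReal_one, one_smul]
  have hcontres : ∀ k, ContinuousOn (fun t => S.res (t + ε k)) (Set.Ioi 0) := by
    intro k
    refine (continuousOn_res hS).comp (by fun_prop) fun t ht => ?_
    have ht : 0 < t := ht
    have := hε' k
    change 0 < t + ε k
    linarith
  have hbd : ∀ k t, 0 < t → ∀ m : ℕ,
      ‖(S.res (t + ε k) * S.negRes s) ^ m‖ ≤ (M * (1 + M)) ^ m * s ^ (-(m : ℝ)) ∧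
      ‖(S.res (t + ε k) * S.negRes s) ^ m‖ ≤ (M * (1 + M)) ^ m * t ^ (-(m : ℝ)) := by
    intro k t ht m
    have hk := hε' k
    obtain ⟨h1, h2⟩ := norm_res_mul_negRes_pow_le hS hM hs (add_pos ht hk) m
    refine ⟨h1, h2.trans ?_⟩
    gcongr ?_ * ?_
    exact Real.rpow_le_rpow_of_nonpos ht (by linarith) (by simp)
  have hpow : ∀ k t, 0 < t → S.res (t + ε k) ^ n * S.negRes s ^ n =
      (S.res (t + ε k) * S.negRes s) ^ n := by
    intro k t ht
    rw [Commute.mul_pow]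
    exact commute_negRes hS hs (res_commute_T hS (add_pos ht (hε' k)))
  have hint : ∀ k, IntegrableOn (fun t : ℝ => ((t ^ (δ - 1) : ℝ) : ℂ) • S.res (t + ε k) ^ n)
      (Set.Ioi 0) := by
    intro k
    have hk := hε' k
    have hn0 : 0 < n := by
      have : (0 : ℝ) < n := by linarith
      exact_mod_cast this
    have hb : ∀ t : ℝ, 0 < t → ∀ r : ℝ, 0 < r → r ≤ t + ε k →
        ‖S.res (t + ε k) ^ n‖ ≤ M * r ^ (-(n : ℝ)) := by
      intro t ht r hr hrt
      refine (norm_res_pow_le hS hM (by linarith) hn0).trans ?_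
      gcongr ?_ * ?_
      exact Real.rpow_le_rpow_of_nonpos hr hrt (by simp)
    exact integrableOn_rpow_smul hδ hn' ((hcontres k).pow n)
      (fun t ht => hb t ht (ε k) hk (by linarith)) (fun t ht => hb t ht t ht (by linarith))
  have hmul : ∀ k (L : X →L[ℂ] X), S.shiftPow hS ha (hε k) * L =
      c • ∫ t in Set.Ioi (0 : ℝ), ((t ^ (δ - 1) : ℝ) : ℂ) • (S.res (t + ε k) ^ n * L) := by
    intro k L
    have h2 := ((ContinuousLinearMap.mul ℂ (X →L[ℂ] X)).flip L).integral_comp_comm (hint k)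
    simp only [ContinuousLinearMap.mul_apply', ContinuousLinearMap.flip_apply] at h2
    rw [hJ, smul_mul_assoc, ← h2]
    simp only [smul_mul_assoc]
  have hlim : ∀ t, 0 < t → Tendsto (fun k => S.res (t + ε k)) atTop (𝓝 (S.res t)) := by
    intro t ht
    have h1 : ContinuousAt S.res t := (continuousOn_res hS).continuousAt (Ioi_mem_nhds ht)
    refine h1.tendsto.comp ?_
    simpa using tendsto_const_nhds.add hε0
  constructor
  · simp only [hmul]
    refine Tendsto.const_smul (tendsto_integral_rpow_smul (p := n) hδ hn'
      (fun k => ((hcontres k).pow n).mul continuousOn_const)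
      (fun k t ht => (hpow k t ht ▸ (hbd k t ht n).1))
      (fun k t ht => (hpow k t ht ▸ (hbd k t ht n).2)) fun t ht => ?_) c
    rw [negRes_pow_mul_res_pow hS hs ht]
    exact (((hlim t ht).mul_const _).pow n).congr fun k => (hpow k t ht).symm
  · simp_rw [mul_assoc]
    simp only [hmul]
    -- The extra factor -A R(ε, A) is controlled in the limit only next to some -A R(s, A), so one
    -- of the n copies is split off to absorb it.
    obtain ⟨m, rfl⟩ : ∃ m, n = m + 1 := by
      refine Nat.exists_eq_succ_of_ne_zero ?_
      rintro rfl
      simp at hn'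
      linarith
    have hb1 : ∀ k, ‖S.negRes (ε k)‖ ≤ 1 + M := fun k => norm_negRes_le hS hM (hε' k)
    refine Tendsto.const_smul (tendsto_integral_rpow_smul (p := (m + 1 : ℕ)) hδ hn'
      (a := (M * (1 + M)) ^ (m + 1) * s ^ (-((m + 1 : ℕ) : ℝ)) * (1 + M))
      (b := (M * (1 + M)) ^ (m + 1) * (1 + M))
      (fun k => ((hcontres k).pow _).mul continuousOn_const)
      (fun k t ht => ?_) (fun k t ht => ?_) fun t ht => ?_) c
    · change ‖S.res (t + ε k) ^ (m + 1) * (S.negRes s ^ (m + 1) * S.negRes (ε k))‖ ≤ _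
      rw [← mul_assoc, hpow k t ht]
      refine (norm_mul_le _ _).trans ?_
      gcongr
      exacts [(hbd k t ht _).1, hb1 k]
    · change ‖S.res (t + ε k) ^ (m + 1) * (S.negRes s ^ (m + 1) * S.negRes (ε k))‖ ≤ _
      rw [← mul_assoc, hpow k t ht, mul_right_comm]
      refine (norm_mul_le _ _).trans ?_
      gcongr
      exacts [(hbd k t ht _).2, hb1 k]
    · rw [negRes_pow_mul_res_pow hS hs ht]
      have e : ∀ k, S.res (t + ε k) ^ (m + 1) * (S.negRes s ^ (m + 1) * S.negRes (ε k)) =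
          (S.res (t + ε k) * S.negRes s) ^ m *
            (S.res (t + ε k) * (S.negRes (ε k) * S.negRes s)) := by
        intro k
        rw [← mul_assoc, hpow k t ht, pow_succ, mul_assoc, mul_assoc]
        congr 2
        exact commute_negRes hS (hε' k) (negRes_commute_T hS hs)
      rw [pow_succ]
      exact ((((hlim t ht).mul_const _).pow m).mul
        ((hlim t ht).mul (tendsto_negRes_mul_negRes hS hε' hε0 hs))).congr fun k => (e k).symm

omit hS in
theorem exists_pos_tendsto_zero :
    ∃ ε : ℕ → ℝ, (∀ k, 0 < ((ε k : ℝ) : ℂ).re) ∧ Tendsto ε atTop (𝓝 0) :=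
  ⟨fun k => 1 / ((k : ℝ) + 1), fun k => by rw [Complex.ofReal_re]; positivity,
    tendsto_one_div_add_atTop_nhds_zero_nat⟩

/-- Before the limit, (ε-A)^(-a) (ε-A)^(-δ) = R(ε, A)^n, and R(ε, A)^n [-A R(r, A)]^n = [-A R(ε,
A)]^n R(r, A)^n. The factor -A R(ε, A) disappears in the limit next to -A R(s, A). -/
theorem balak_mul_balak {δ a r s : ℝ} {n : ℕ} (hδ : 0 < δ) (ha : 0 < a) (hn : δ + a = n)
    (hr : 0 < r) (hs : 0 < s) :
    S.balak δ n s * S.balak a n r = S.negRes s ^ n * S.res r ^ n := by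
  obtain ⟨ε, hε, hε0⟩ := exists_pos_tendsto_zero
  have hε' : ∀ k, 0 < ε k := fun k => by simpa using hε k
  have hn0 : 0 < n := by
    have : (0 : ℝ) < n := by linarith
    exact_mod_cast this
  have h1 := (tendsto_shiftPow_mul_negRes_pow hS hδ ha hn hs hε hε0).1
  have h2 := (tendsto_shiftPow_mul_negRes_pow hS ha hδ (by linarith) hr hε hε0).1
  have h3 := h1.mul h2
  have h4 := ((tendsto_negRes_mul_negRes hS hε' hε0 hs).pow n).mul_const (S.res r ^ n)
  refine tendsto_nhds_unique h3 (h4.congr fun k => ?_)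
  have c1 : Commute (S.negRes s) (S.shiftPow hS hδ (hε k)) :=
    commute_shiftPow hS hδ (hε k) (negRes_commute_T hS hs)
  have c2 : Commute (S.negRes s) (S.res (ε k)) :=
    commute_res hS (hε' k) (negRes_commute_T hS hs)
  have c3 : Commute (S.negRes s) (S.negRes (ε k)) :=
    commute_negRes hS (hε' k) (negRes_commute_T hS hs)
  have c4 : Commute (S.negRes r) (S.res (ε k)) :=
    commute_res hS (hε' k) (negRes_commute_T hS hr)
  have c5 : Commute (S.negRes (ε k)) (S.res r) :=
    commute_res hS hr (negRes_commute_T hS (hε' k))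
  have e1 : S.shiftPow hS ha (hε k) * S.shiftPow hS hδ (hε k) = S.res (ε k) ^ n := by
    rw [shiftPow_mul, res, resolventOp_pow_eq hS (hε k) hn0]
    congr 1
    linarith
  calc (S.negRes (ε k) * S.negRes s) ^ n * S.res r ^ n
      = S.negRes s ^ n * (S.negRes (ε k) * S.res r) ^ n := by
        rw [c3.symm.mul_pow, c5.mul_pow, (c3.symm.pow_pow n n).eq, mul_assoc]
    _ = S.negRes s ^ n * (S.res (ε k) ^ n * S.negRes r ^ n) := by
        rw [← res_mul_negRes hS hr (hε' k), c4.symm.mul_pow]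
    _ = S.shiftPow hS ha (hε k) * S.negRes s ^ n *
          (S.shiftPow hS hδ (hε k) * S.negRes r ^ n) := by
        rw [← e1, ← ((commute_shiftPow hS ha (hε k) (negRes_commute_T hS hs)).pow_left n).eq]
        simp only [mul_assoc]

/-- Raising n by one adds the factor R(ε, A)(-A)R(s, A) = -A R(ε, A) R(s, A) to the approximants;
the second limit above removes -A R(ε, A). The lemma makes the choice of n immaterial. -/
theorem balak_succ {δ s : ℝ} {n : ℕ} (hδ : 0 < δ) (hn : δ < n) (hs : 0 < s) :
    S.balak δ (n + 1) s = S.balak δ n s * S.res s := by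
  obtain ⟨ε, hε, hε0⟩ := exists_pos_tendsto_zero
  have hε' : ∀ k, 0 < ε k := fun k => by simpa using hε k
  have ha : 0 < (n : ℝ) - δ := by linarith
  have h1 := (tendsto_shiftPow_mul_negRes_pow hS hδ (a := n - δ + 1) (n := n + 1) (by linarith)
    (by push_cast; ring) hs hε hε0).1
  have h2 := (tendsto_shiftPow_mul_negRes_pow hS hδ ha (by ring) hs hε hε0).2.mul_const (S.res s)
  refine tendsto_nhds_unique h1 (h2.congr fun k => ?_)
  have c2 : Commute (S.negRes s) (S.res (ε k)) :=
    commute_res hS (hε' k) (negRes_commute_T hS hs)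
  rw [← shiftPow_mul hS ha one_pos, ← resolventOp_eq hS (hε k)]
  change _ = _ * S.res (ε k) * _
  rw [mul_assoc _ (S.negRes (ε k)), ← res_mul_negRes hS hs (hε' k), pow_succ]
  simp only [mul_assoc]
  rw [← mul_assoc (S.negRes s ^ n), (c2.pow_left n).eq, mul_assoc]

theorem balak_add {δ s : ℝ} {n : ℕ} (hδ : 0 < δ) (hn : δ < n) (hs : 0 < s) (k : ℕ) :
    S.balak δ (n + k) s = S.balak δ n s * S.res s ^ k := by
  induction k with
  | zero => simp
  | succ k ih =>
    rw [← add_assoc, balak_succ hS hδ (by push_cast; linarith [k.cast_nonneg (α := ℝ)]) hs, ih,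
      mul_assoc, pow_succ]

end

end C0Semigroup

end SemigroupWeiss

end

/-! ### The graph of (-A)^δ and density of the ranges of (I - A)^(-n) -/

noncomputable section

namespace SemigroupWeiss

variable {X : Type*} [NormedAddCommGroup X] [NormedSpace ℂ X]

theorem exists_graph_of_mem_pcomp {g f : X →ₗ.[ℂ] X} (x : (pcomp g f).domain) :
    ∃ y, ∃ hy : y ∈ g.domain, ((x : X), y) ∈ f.graph ∧ pcomp g f x = g ⟨y, hy⟩ :=
  ⟨f ⟨x, x.2.choose⟩, x.2.choose_spec, f.mem_graph ⟨x, x.2.choose⟩, rfl⟩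

theorem pcomp_of_mem_graph {g f : X →ₗ.[ℂ] X} {x y : X} (h : (x, y) ∈ f.graph)
    (hy : y ∈ g.domain) : ∃ hx : x ∈ (pcomp g f).domain, pcomp g f ⟨x, hx⟩ = g ⟨y, hy⟩ := by
  obtain ⟨z, hz, e⟩ := f.mem_graph_iff.1 h
  simp only at hz e
  subst hz
  subst e
  exact ⟨⟨z.2, hy⟩, rfl⟩

namespace C0Semigroup

variable {S : C0Semigroup X} [CompleteSpace X] (hS : S.IsBounded)
include hS

omit hS [CompleteSpace X] in
theorem res_one (S : C0Semigroup X) : S.res 1 = resolventOp S.generator 1 := by simp [res]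

theorem one_mem_resolventSet : (1 : ℂ) ∈ resolventSet S.generator :=
  mem_resolventSet hS (by simp)

theorem res_one_injective : Function.Injective (S.res 1) := by
  rw [res_one, injective_iff_map_eq_zero]
  intro x hx
  obtain ⟨h, e⟩ := (isResolventAt_resolventOp (one_mem_resolventSet hS)).1 x
  have h0 : (⟨resolventOp S.generator 1 x, h⟩ : S.generator.domain) = 0 := Subtype.ext hx
  rw [h0, S.generator.map_zero, hx] at e
  simpa using e.symm

theorem res_one_pow_injective (n : ℕ) : Function.Injective (S.res 1 ^ n) := by
  have h : ⇑(S.res 1 ^ n) = (S.res 1)^[n] := by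
    induction n with
    | zero => rfl
    | succ n ih => rw [pow_succ, Function.iterate_succ, ← ih]; rfl
  rw [h]
  exact (res_one_injective hS).iterate n

theorem resolventOp_eq_res_one {z : ℂ} (hz : 0 < z.re) :
    resolventOp S.generator z = S.res 1 * (1 + (1 - z) • resolventOp S.generator z) := by
  have h := resolventOp_sub (mem_resolventSet hS hz) (one_mem_resolventSet hS)
  rw [sub_eq_iff_eq_add] at h
  rw [mul_add, mul_one, mul_smul_comm, res_one, add_comm]
  exact h

/-- After the substitution u = λs, λR(λ, A)x is the mean of T(u/λ)x against e^(-u) du, and strong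
continuity at 0 applies under the integral. -/
theorem tendsto_smul_resolventOp (x : X) :
    Tendsto (fun k : ℕ => ((k + 1 : ℝ) : ℂ) • resolventOp S.generator ((k + 1 : ℝ) : ℂ) x) atTop
      (𝓝 x) := by
  obtain ⟨M, hM⟩ := id hS
  have e : ∀ k : ℕ, ((k + 1 : ℝ) : ℂ) • resolventOp S.generator ((k + 1 : ℝ) : ℂ) x =
      ∫ u in Set.Ioi (0 : ℝ), ((Real.exp (-u) : ℝ) : ℂ) • S.real (u / (k + 1)) x := by
    intro k
    have hk : (0 : ℝ) < k + 1 := by positivity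
    have hz : 0 < ((k + 1 : ℝ) : ℂ).re := by rwa [Complex.ofReal_re]
    have := integral_comp_mul_left_Ioi'
      (fun u : ℝ => ((Real.exp (-u) : ℝ) : ℂ) • S.real (u / (k + 1)) x) 0 hk
    rw [mul_zero] at this
    rw [← this, resolventOp_eq hS hz, shiftPow_one_apply, Complex.coe_smul]
    congr 1
    refine setIntegral_congr_fun measurableSet_Ioi fun s _ => ?_
    rw [mul_div_cancel_left₀ _ hk.ne']
    push_cast
    rfl
  have hexp : IntegrableOn (fun u : ℝ => Real.exp (-u)) (Set.Ioi 0) := integrableOn_exp_neg_Ioi 0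
  have h0 : x = ∫ u in Set.Ioi (0 : ℝ), ((Real.exp (-u) : ℝ) : ℂ) • x := by
    rw [integral_smul_const, integral_complex_ofReal, integral_exp_neg_Ioi_zero]
    simp
  simp only [e]
  nth_rewrite 2 [h0]
  refine tendsto_integral_of_dominated_convergence (fun u => Real.exp (-u) * (M * ‖x‖))
    (fun k => ?_) (hexp.mul_const _) (fun k => ?_) (Eventually.of_forall fun u => ?_)
  · have := continuous_real hM x
    exact (by fun_prop : Continuous fun u : ℝ =>
      ((Real.exp (-u) : ℝ) : ℂ) • S.real (u / (k + 1)) x).aestronglyMeasurable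
  · refine Eventually.of_forall fun u => ?_
    rw [norm_smul, Complex.norm_real, Real.norm_of_nonneg (Real.exp_pos _).le]
    gcongr
    exact norm_real_le hM _ x
  · refine Tendsto.const_smul ?_ _
    have h1 : Tendsto (fun k : ℕ => u / ((k : ℝ) + 1)) atTop (𝓝 0) := by
      simpa [div_eq_mul_inv] using
        (tendsto_one_div_add_atTop_nhds_zero_nat (𝕜 := ℝ)).const_mul u
    have h2 := ((continuous_real hM x).tendsto 0).comp h1
    simpa [real, S.map_zero'] using! h2

theorem denseRange_res_one : DenseRange (S.res 1) := by
  intro x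
  refine mem_closure_of_tendsto (tendsto_smul_resolventOp hS x) (Eventually.of_forall fun k => ?_)
  have hz : 0 < ((k + 1 : ℝ) : ℂ).re := by rw [Complex.ofReal_re]; positivity
  rw [resolventOp_eq_res_one hS hz]
  exact ⟨_, map_smul _ _ _⟩

theorem denseRange_res_one_pow (n : ℕ) : DenseRange (S.res 1 ^ n) := by
  induction n with
  | zero => exact denseRange_id
  | succ n ih =>
    rw [pow_succ]
    exact ih.comp (denseRange_res_one hS) (S.res 1 ^ n).continuous

omit hS [CompleteSpace X] in
theorem eq_of_mul_eq_of_denseRange {F G D : X →L[ℂ] X} (hD : DenseRange D) (h : F * D = G * D) :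
    F = G := by
  refine ContinuousLinearMap.coeFn_injective (hD.equalizer F.continuous G.continuous ?_)
  exact congrArg DFunLike.coe h

theorem mem_graph_negPow_iff {δ : ℝ} {x y : X} :
    (x, y) ∈ (negPow S.generator δ).graph ↔
      (S.res 1 ^ (⌊δ⌋₊ + 1)) y = S.balak δ (⌊δ⌋₊ + 1) 1 x := by
  rw [mem_graph_negPow (one_mem_resolventSet hS), balakrishnan_eq, res_one]

theorem mem_graph_negPow_res_pow {δ : ℝ} (hδ : 0 < δ) (w : X) :
    ((S.res 1 ^ (⌊δ⌋₊ + 1)) w, S.balak δ (⌊δ⌋₊ + 1) 1 w) ∈ (negPow S.generator δ).graph := by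
  rw [mem_graph_negPow_iff hS]
  have hn : δ < ((⌊δ⌋₊ + 1 : ℕ) : ℝ) := by push_cast; exact Nat.lt_floor_add_one δ
  have h : Commute (S.res 1) (S.balak δ (⌊δ⌋₊ + 1) 1) :=
    commute_balak hS hδ hn one_pos (res_commute_T hS one_pos)
  exact congrArg (fun P : X →L[ℂ] X => P w) (h.pow_left (⌊δ⌋₊ + 1)).eq

/-- `x ∈ D((-A)^δ)` and `(-A)^δ x ∈ D(A)` imply `x ∈ D(A)`. -/
theorem exists_res_of_balak_eq {δ : ℝ} {m : ℕ} (hδ : 0 < δ) (hm : δ < m) {x y : X}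
    (h : (S.res 1 ^ m) (S.res 1 y) = S.balak δ m 1 x) : ∃ x', x = S.res 1 x' := by
  have hmδ : 0 < (m : ℝ) - δ := by linarith
  -- Applying (-A)^(m-δ) (I-A)^(-m) to the hypothesis turns its right side into (I-A)^(-m) [-A R(1,
  -- A)]^m x, and the injective factor (I-A)^(-m) cancels.
  have e := balak_mul_balak hS hmδ hδ (by ring) one_pos one_pos (n := m) (S := S)
  have hr : ∀ t, Commute (S.res 1) (S.T t) := res_commute_T hS one_pos
  have hP := commute_balak hS hmδ (by linarith) one_pos hr (n := m)
  have hb : Commute (S.negRes 1) (S.res 1) :=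
    commute_res hS one_pos (negRes_commute_T hS one_pos)
  have e1 : (S.res 1 ^ m) (S.res 1 (S.balak (m - δ) m 1 y)) =
      (S.res 1 ^ m) ((S.negRes 1 ^ m) x) := by
    have e2 : S.res 1 ^ m * S.res 1 * S.balak (m - δ) m 1 =
        S.balak (m - δ) m 1 * (S.res 1 ^ m * S.res 1) := by
      rw [← pow_succ]
      exact (hP.pow_left _).eq
    have e3 := congrArg (fun P : X →L[ℂ] X => P y) e2
    have e4 := congrArg (fun P : X →L[ℂ] X => P x) (e.trans (hb.pow_pow m m).eq)
    simp only [mul_apply_eq_comp] at e3 e4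
    rw [e3, h, e4]
  have e2 := res_one_pow_injective hS m e1
  -- Since -A R(1, A) = I - R(1, A), its m-th power is the identity up to the range of R(1, A), so x
  -- itself lies in that range.
  obtain ⟨G, hG⟩ : ∃ G : X →L[ℂ] X, S.negRes 1 ^ m = 1 - S.res 1 * G := by
    have h1 : S.res 1 = 1 - S.negRes 1 := by simp [negRes]
    refine ⟨∑ i ∈ Finset.range m, S.negRes 1 ^ i, ?_⟩
    rw [h1, mul_neg_geom_sum]
    abel
  rw [hG] at e2
  refine ⟨S.balak (m - δ) m 1 y + G x, ?_⟩
  rw [map_add, e2]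
  simp

/-! ### Interpolation and the Laplace transform -/

variable {C : S.generator.domain →ₗ[ℂ] X}

theorem exists_comp_res_one (hC : GraphBounded S.generator C)
    (hcomm : ∀ t, CommutesWith (S.T t) (asOp C)) :
    ∃ Q : X →L[ℂ] X, (∀ t, Commute Q (S.T t)) ∧
      ∀ x (h : S.res 1 x ∈ S.generator.domain), Q x = C ⟨S.res 1 x, h⟩ := by
  obtain ⟨K, hK⟩ := hC
  have hR := isResolventAt_resolventOp (one_mem_resolventSet hS)
  rw [← res_one] at hR
  let Q₀ : X →ₗ[ℂ] X := C ∘ₗ (S.res 1).toLinearMap.codRestrict S.generator.domain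
    fun x => (hR.1 x).1
  have hbd : ∃ K', ∀ x, ‖Q₀ x‖ ≤ K' * ‖x‖ := by
    refine ⟨|K| * (‖S.res 1‖ + (‖S.res 1‖ + 1)), fun x => ?_⟩
    obtain ⟨h, e⟩ := hR.1 x
    refine (hK ⟨S.res 1 x, h⟩).trans ?_
    have e1 : S.generator ⟨S.res 1 x, h⟩ = S.res 1 x - x := by
      rw [eq_sub_iff_add_eq']
      rw [one_smul, sub_eq_iff_eq_add] at e
      exact e.symm
    rw [e1, mul_assoc]
    have h1 := (S.res 1).le_opNorm x
    have h2 := norm_sub_le (S.res 1 x) x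
    gcongr
    · exact le_abs_self K
    · simp only
      linarith
  refine ⟨Q₀.mkContinuousOfExistsBound hbd, fun t => ?_, fun x h => rfl⟩
  ext x
  change C ⟨S.res 1 (S.T t x), _⟩ = S.T t (C ⟨S.res 1 x, _⟩)
  obtain ⟨h, e⟩ := hcomm t ⟨S.res 1 x, (hR.1 x).1⟩
  refine Eq.trans ?_ e
  change _ = C _
  congr 1
  exact Subtype.ext (congrArg (fun P : X →L[ℂ] X => P x) (res_commute_T hS one_pos t).eq)

/-- The interpolation inequality between `Q T(t)` and `Q (-A)^α T(t)`. -/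
theorem exists_norm_balak_comp_le {α γ b : ℝ} {n : ℕ} (hγ : 0 < γ) (hγα : γ < α) (hn : α < n)
    (Q : X →L[ℂ] X) (hQ : ∀ t, Commute Q (S.T t)) {M₁ M₂ : ℝ} (hM₁ : 0 ≤ M₁) (hM₂ : 0 ≤ M₂)
    (h₁ : ∀ t : ℝ≥0, 0 < t → ∀ w,
      ‖Q (S.balak α n 1 (S.T t w))‖ ≤ M₁ * ‖(S.res 1 ^ (n + 1)) w‖)
    (h₂ : ∀ t : ℝ≥0, 0 < t → ∀ w, ‖Q (S.T t w)‖ ≤ M₂ * (t : ℝ) ^ (-b) * ‖S.res 1 w‖) :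
    ∃ K : ℝ, 0 ≤ K ∧ ∀ t : ℝ≥0, 0 < t → ∀ w,
      ‖Q (S.balak γ n 1 (S.T t w))‖ ≤
        K * (t : ℝ) ^ (-b * (1 - γ / α)) * ‖(S.res 1 ^ (n + 1)) w‖ := by
  obtain ⟨M, hM⟩ := id hS
  have hM0 := bound_nonneg hM
  have hα : 0 < α := hγ.trans hγα
  have hγn : γ < n := hγα.trans hn
  have hnα : 0 < (n : ℝ) - α := by linarith
  have hαγ : 0 < α - γ := by linarith
  obtain ⟨K, hK, hKb⟩ := exists_norm_balak_le hS hnα (show (n : ℝ) - α < n by linarith)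
  set c := ‖((Real.Gamma n / (Real.Gamma γ * Real.Gamma (n - γ)) : ℝ) : ℂ)‖
  -- The two summands come from Balakrishnan's integral below and above the splitting point t^(b/α).
  refine ⟨c * ((1 + M) ^ n * M₂ / γ + K * M₁ / (α - γ)), by positivity, fun t ht w => ?_⟩
  have ht' : (0 : ℝ) < t := ht
  set N := ‖(S.res 1 ^ (n + 1)) w‖ with hN
  have hr := res_commute_T hS one_pos
  have cQP : Commute Q (S.balak γ n 1) := commute_balak hS hγ hγn one_pos hQ
  have cQα : Commute Q (S.balak α n 1) := commute_balak hS hα hn one_pos hQ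
  have cQr : Commute Q (S.res 1) := commute_res hS one_pos hQ
  have e1 : Q (S.balak γ n 1 (S.T t w)) = S.balak γ n 1 (Q (S.T t w)) :=
    congrArg (fun P : X →L[ℂ] X => P (S.T t w)) cQP.eq
  have e2 : Q (S.balak α n 1 (S.T t w)) = S.balak α n 1 (Q (S.T t w)) :=
    congrArg (fun P : X →L[ℂ] X => P (S.T t w)) cQα.eq
  have e3 : (S.res 1 ^ n) (Q (S.T t w)) = Q (S.T t ((S.res 1 ^ n) w)) := by
    have : S.res 1 ^ n * Q * S.T t = Q * S.T t * S.res 1 ^ n := by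
      rw [← (cQr.pow_right n).eq, mul_assoc, ((hr t).pow_left n).eq, mul_assoc]
    exact congrArg (fun P : X →L[ℂ] X => P w) this
  have hra : ‖(S.res 1 ^ n) (Q (S.T t w))‖ ≤ M₂ * (t : ℝ) ^ (-b) * N := by
    rw [e3, hN, pow_succ']
    exact h₂ t ht _
  have hrb := h₁ t ht w
  rw [e2] at hrb
  have ha : ∀ τ, 0 < τ → ‖(S.negRes τ ^ n) ((S.res 1 ^ n) (Q (S.T t w)))‖ ≤
      (1 + M) ^ n * (M₂ * (t : ℝ) ^ (-b) * N) := by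
    intro τ hτ
    have hn0 : 0 < n := by
      have : (0 : ℝ) < n := by linarith
      exact_mod_cast this
    have h := norm_pow_le' (S.negRes τ) hn0
    refine ((S.negRes τ ^ n).le_opNorm _).trans ?_
    gcongr
    refine h.trans ?_
    gcongr
    exact norm_negRes_le hS hM hτ
  -- Here [-A R(τ, A)]^n R(1, A)^n is factored as (-A)^(n-α) (τ-A)^(-n) times (-A)^α (I-A)^(-n): the
  -- first factor is O(τ^(-α)), the second is controlled by `h₁`.
  have hb : ∀ τ, 0 < τ → ‖(S.negRes τ ^ n) ((S.res 1 ^ n) (Q (S.T t w)))‖ ≤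
      (K * (M₁ * N)) * τ ^ (-α) := by
    intro τ hτ
    have e := congrArg (fun P : X →L[ℂ] X => P (Q (S.T t w)))
      (balak_mul_balak hS hnα hα (by ring) one_pos hτ (n := n) (S := S))
    simp only [mul_apply_eq_comp] at e
    rw [← e]
    have hk := hKb τ hτ
    rw [show (n : ℝ) - α - n = -α by ring] at hk
    calc _ ≤ ‖S.balak (n - α) n τ‖ * ‖S.balak α n 1 (Q (S.T t w))‖ :=
          (S.balak (n - α) n τ).le_opNorm _
      _ ≤ (K * τ ^ (-α)) * (M₁ * N) := by gcongr
      _ = _ := by ring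
  -- The splitting point s solves t^(-b) s^γ = s^(γ-α), so both parts have the same order in t.
  have hs : 0 < (t : ℝ) ^ (b / α) := by positivity
  have h := norm_integral_rpow_smul_le hγ hγα hs ha hb
  rw [e1, balak_apply hS hγ hγn one_pos, norm_smul, mul_assoc c, mul_assoc c]
  refine mul_le_mul_of_nonneg_left (h.trans_eq ?_) (norm_nonneg _)
  have p1 : (t : ℝ) ^ (-b) * ((t : ℝ) ^ (b / α)) ^ γ = (t : ℝ) ^ (-b * (1 - γ / α)) := by
    rw [← Real.rpow_mul ht'.le, ← Real.rpow_add ht']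
    congr 1
    field_simp
    ring
  have p2 : ((t : ℝ) ^ (b / α)) ^ (γ - α) = (t : ℝ) ^ (-b * (1 - γ / α)) := by
    rw [← Real.rpow_mul ht'.le]
    congr 1
    field_simp
    ring
  rw [p2, ← p1]
  field_simp

/-- A bound on `L T(t) w` of order `t^(-1/2)` gives a bound on `L R(z, A) w` of order
`(Re z)^(-1/2)`. -/
theorem norm_comp_resolventOp_le (L : X →L[ℂ] X) {K : ℝ} (w : X)
    (h : ∀ t : ℝ≥0, 0 < t → ‖L (S.T t w)‖ ≤ K * (t : ℝ) ^ (-(1 / 2) : ℝ)) {z : ℂ}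
    (hz : 0 < z.re) :
    ‖L (resolventOp S.generator z w)‖ ≤ K * Real.Gamma (1 / 2) / z.re ^ (1 / 2 : ℝ) := by
  obtain ⟨M, hM⟩ := id hS
  have hexp : IntegrableOn (fun s : ℝ => Complex.exp (-(z * s))) (Set.Ioi 0) := by
    refine (integrableOn_gammaKernel one_pos hz).congr_fun (fun s _ => ?_) measurableSet_Ioi
    simp [gammaKernel]
  have hi := integrable_smul_real hM hexp w
  rw [resolventOp_eq hS hz, shiftPow_one_apply, ← L.integral_comp_comm hi]
  have hb := (integrableOn_rpow_mul_exp (a := 1 / 2) (by norm_num) hz).const_mul K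
  refine (norm_integral_le_of_norm_le hb ?_).trans_eq ?_
  · refine (ae_restrict_iff' measurableSet_Ioi).2 (Eventually.of_forall fun s hs => ?_)
    have hs' : 0 < s := hs
    have h1 := h s.toNNReal (Real.toNNReal_pos.2 hs')
    rw [Real.coe_toNNReal _ hs'.le] at h1
    rw [map_smul, norm_smul, Complex.norm_exp, mul_comm, mul_comm (s ^ _), ← mul_assoc,
      mul_comm K, mul_assoc, mul_comm]
    have e : (-(z * (s : ℂ))).re = -(z.re * s) := by simp
    rw [e, show (1 / 2 - 1 : ℝ) = -(1 / 2) by norm_num]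
    gcongr
    exact h1
  · rw [integral_const_mul, Real.integral_rpow_mul_exp_neg_mul_Ioi (by norm_num) hz, one_div,
      Real.inv_rpow hz.le]
    ring

end C0Semigroup

end SemigroupWeiss

end

/-! ### Extension of C(-A)^γ to D(A) -/

noncomputable section

namespace SemigroupWeiss

variable {X : Type*} [NormedAddCommGroup X] [NormedSpace ℂ X] [CompleteSpace X]

namespace C0Semigroup

variable {S : C0Semigroup X} (hS : S.IsBounded) {C : S.generator.domain →ₗ[ℂ] X}
include hS

/-- If `C (-A)^γ T(t)` is `O(t^(-1/2))` on `D(A^(n+1))`, then `C` satisfies the strong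
`2`-Weiss condition with exponent `γ`. -/
theorem strongTwoWeissWith_of_le {γ K : ℝ} (hγ : 0 < γ) {n : ℕ} (hn : ⌊γ⌋₊ + 1 ≤ n)
    {Q : X →L[ℂ] X} (hQ : ∀ t, Commute Q (S.T t))
    (hQC : ∀ x (h : S.res 1 x ∈ S.generator.domain), Q x = C ⟨S.res 1 x, h⟩)
    (hK : ∀ t : ℝ≥0, 0 < t → ∀ w, ‖Q (S.balak γ n 1 (S.T t w))‖ ≤
        K * (t : ℝ) ^ (-(1 / 2) : ℝ) * ‖(S.res 1 ^ (n + 1)) w‖) :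
    StrongTwoWeissWith S.generator C γ := by
  set m := ⌊γ⌋₊ + 1 with hm
  have hγm : γ < m := by rw [hm]; push_cast; exact Nat.lt_floor_add_one γ
  obtain ⟨k, rfl⟩ := Nat.exists_eq_add_of_le hn
  set r := S.res 1 with hr
  set P := S.balak γ m 1 with hP
  set L := Q * S.balak γ (m + k) 1 with hL
  -- The graph of (-A)^γ is defined with m = ⌊γ⌋ + 1 resolvents, while the bound is given with m + k
  -- of them.
  have hLP : L = Q * P * r ^ k := by rw [hL, balak_add hS hγ hγm one_pos, mul_assoc]
  have hrT : ∀ t, Commute r (S.T t) := res_commute_T hS one_pos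
  have cQr : Commute Q r := commute_res hS one_pos hQ
  have cPr : Commute r P := commute_balak hS hγ hγm one_pos hrT
  have hLR : ∀ (z : ℂ), 0 < z.re → ∀ w, ‖L (resolventOp S.generator z w)‖ ≤
      K * Real.Gamma (1 / 2) / z.re ^ (1 / 2 : ℝ) * ‖(r ^ (m + k + 1)) w‖ := by
    intro z hz w
    refine (norm_comp_resolventOp_le hS L (K := K * ‖(r ^ (m + k + 1)) w‖) w
      (fun t ht => (hK t ht w).trans_eq (by ring)) hz).trans_eq (by ring)
  have hdense : ∀ j : ℕ, DenseRange ⇑(r ^ j) := denseRange_res_one_pow hS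
  have hLr : ∀ w, ‖(L * r).toLinearMap w‖ ≤
      K * Real.Gamma (1 / 2) * ‖(r ^ (m + k + 1)).toLinearMap w‖ := by
    intro w
    have := hLR 1 (by simp) w
    rw [← res_one, Complex.one_re, Real.one_rpow, div_one] at this
    exact this
  -- Formally L r = [C(-A)^γ r] r^(m+k+1), so `F` is the bounded extension of C(-A)^γ (I-A)⁻¹; the
  -- bound it needs is the resolvent estimate at z = 1.
  set F : X →L[ℂ] X := (L * r).toLinearMap.extendOfNorm (r ^ (m + k + 1)).toLinearMap with hF
  have hFD : F * r ^ (m + k + 1) = L * r := by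
    ext w
    exact LinearMap.extendOfNorm_eq (hdense _) ⟨_, hLr⟩ w
  have hFm : F * r ^ m = Q * P := by
    refine eq_of_mul_eq_of_denseRange (hdense (k + 1)) ?_
    rw [mul_assoc, ← pow_add, ← add_assoc, hFD, hLP, pow_succ, mul_assoc]
  have hFr : F * r = r * F := by
    refine eq_of_mul_eq_of_denseRange (hdense m) ?_
    calc F * r * r ^ m = F * r ^ m * r := by rw [mul_assoc, mul_assoc, ← pow_succ', pow_succ]
      _ = r * F * r ^ m := by
        rw [mul_assoc r, hFm, mul_assoc, ← cPr.eq, ← mul_assoc, cQr.eq, mul_assoc]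
  have hres : ∀ x (h : r x ∈ S.generator.domain), r x - S.generator ⟨r x, h⟩ = x := by
    intro x h
    have := ((isResolventAt_resolventOp (one_mem_resolventSet hS)).1 x).2
    rw [one_smul] at this
    simpa only [hr, res_one] using this
  have hdom : ∀ x, r x ∈ S.generator.domain := by
    intro x
    rw [hr, res_one]
    exact resolventOp_mem_domain _ _ x
  have hsurj : ∀ x : S.generator.domain, r (x - S.generator x) = x := by
    intro x
    have := (isResolventAt_resolventOp (one_mem_resolventSet hS)).2 x
    rwa [one_smul, ← res_one] at this
  let E : S.generator.domain →ₗ[ℂ] X :=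
    F.toLinearMap ∘ₗ (S.generator.domain.subtype - S.generator.toFun)
  have hE : ∀ x : S.generator.domain, E x = F (x - S.generator x) := fun x => rfl
  refine ⟨E, ⟨‖F‖, fun x => ?_⟩, ⟨?_, ?_⟩, ?_⟩
  · rw [hE]
    exact (F.le_opNorm _).trans (by gcongr; exact norm_sub_le _ _)
  · intro x hx
    obtain ⟨y, hy, hxy, -⟩ := exists_graph_of_mem_pcomp ⟨x, hx⟩
    rw [mem_graph_negPow_iff hS] at hxy
    have hy' := hsurj ⟨y, hy⟩
    simp only at hy'
    rw [← hy'] at hxy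
    obtain ⟨x', rfl⟩ := exists_res_of_balak_eq hS hγ hγm hxy
    exact hdom x'
  · intro x z hxz
    obtain ⟨y, hy, hxy, e⟩ := exists_graph_of_mem_pcomp x
    rw [e]
    rw [mem_graph_negPow_iff hS, hxz] at hxy
    change C ⟨y, hy⟩ = F ((z : X) - S.generator z)
    have hz := hsurj z
    have hy' := hsurj ⟨y, hy⟩
    set y' := y - S.generator ⟨y, hy⟩
    set z' := (z : X) - S.generator z
    simp only at hy'
    have hC : C ⟨y, hy⟩ = Q y' := by
      rw [hQC y' (hdom y')]
      congr 1
      exact Subtype.ext hy'.symm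
    rw [hC]
    -- The graph relation for x = r z' and y = r y', with one injective factor r cancelled.
    have h1 : (r ^ m) y' = P z' := by
      apply res_one_injective hS
      have h2 : (r ^ m) (r y') = P (r z') := by rw [hy', hz]; exact hxy
      have h3 := congrArg (fun T : X →L[ℂ] X => T y') ((Commute.refl r).pow_left m).eq
      have h4 := congrArg (fun T : X →L[ℂ] X => T z') cPr.eq
      exact h3.symm.trans (h2.trans h4.symm)
    apply res_one_pow_injective hS m
    have h5 := congrArg (fun T : X →L[ℂ] X => T y') (cQr.pow_right m).eq
    have h6 : (r ^ m) (F z') = F ((r ^ m) z') :=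
      congrArg (fun T : X →L[ℂ] X => T z') ((show Commute F r from hFr).pow_right m).eq.symm
    have h7 : F ((r ^ m) z') = Q (P z') := congrArg (fun T : X →L[ℂ] X => T z') hFm
    change (r ^ m) (Q y') = (r ^ m) (F z')
    rw [h6, h7, ← h1]
    exact h5.symm
  -- The sign of `K` is not prescribed; the absolute value and the added 1 make the constant
  -- positive.
  · refine ⟨|K| * Real.Gamma (1 / 2) + 1, ?_, fun z hz => ⟨mem_resolventSet hS hz, ?_⟩⟩
    · have := Real.Gamma_pos_of_pos (show (0 : ℝ) < 1 / 2 by norm_num)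
      positivity
    · set R := resolventOp S.generator z with hR
      -- B = (I - A)R(z, A), so E R(z, A) = F B. On the dense range of r^(m+k+1) this acts as L R(z,
      -- A), which is already estimated.
      set B : X →L[ℂ] X := 1 + (1 - z) • R with hB
      have hrB : R = r * B := resolventOp_eq_res_one hS hz
      have cRr : Commute r R := commute_resolventOp hS hz hrT
      have cBr : Commute r B := (Commute.one_right r).add_right (cRr.smul_right _)
      have hER : ∀ x h, E ⟨R x, h⟩ = F (B x) := by
        intro x h
        have e : R x = r (B x) := congrArg (fun T : X →L[ℂ] X => T x) hrB
        rw [hE]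
        congr 1
        have := hres (B x) (hdom _)
        rw [← this]
        congr 2
        exact Subtype.ext e
      have hexp : (1 - ((2 : ℝ≥0∞)⁻¹).toReal : ℝ) = 1 / 2 := by
        rw [ENNReal.toReal_inv]
        norm_num
      intro x
      rw [hER, hexp]
      refine (hdense (m + k + 1)).induction_on
        (p := fun x => ‖F (B x)‖ ≤
          (|K| * Real.Gamma (1 / 2) + 1) / z.re ^ (1 / 2 : ℝ) * ‖x‖) x
        (isClosed_le (by fun_prop) (by fun_prop)) fun w => ?_
      have e : F * B * r ^ (m + k + 1) = L * R := by
        rw [mul_assoc, ← (cBr.pow_left _).eq, ← mul_assoc, hFD, mul_assoc, ← hrB]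
      have e' : F (B ((r ^ (m + k + 1)) w)) = L (R w) :=
        congrArg (fun T : X →L[ℂ] X => T w) e
      rw [e']
      refine (hLR z hz w).trans ?_
      have := Real.Gamma_pos_of_pos (show (0 : ℝ) < 1 / 2 by norm_num)
      gcongr
      nlinarith [le_abs_self K]

end C0Semigroup

end SemigroupWeiss

end
-- The main theorem
theorem mainTheorem12 {X : Type*} [NormedAddCommGroup X] [NormedSpace ℂ X] [CompleteSpace X]
    (S : SemigroupWeiss.C0Semigroup X) (hS : S.IsBounded)
    (C : S.generator.domain →ₗ[ℂ] X) (hC : SemigroupWeiss.GraphBounded S.generator C)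
    (hcomm : ∀ t, SemigroupWeiss.CommutesWith (S.T t) (SemigroupWeiss.asOp C))
    (M₁ M₂ α β : ℝ) (hM₁ : 0 < M₁) (hM₂ : 0 < M₂) (hα : 0 < α) (hβ : 0 < β)
    (h₁ : ∀ t : ℝ≥0, 0 < t → ∀ x ∈ (SemigroupWeiss.negPow S.generator (1 + α)).domain,
      ∀ y : (SemigroupWeiss.pcomp (SemigroupWeiss.asOp C)
          (SemigroupWeiss.negPow S.generator α)).domain, (y : X) = S.T t x →
        ‖SemigroupWeiss.pcomp (SemigroupWeiss.asOp C)
          (SemigroupWeiss.negPow S.generator α) y‖ ≤ M₁ * ‖x‖)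
    (h₂ : ∀ t : ℝ≥0, 0 < t → ∀ x : S.generator.domain,
      ‖C ⟨S.T t x, S.map_mem_domain t x⟩‖ ≤ M₂ / √((t : ℝ) ^ (1 + β)) * ‖(x : X)‖) :
    SemigroupWeiss.StrongTwoWeiss S.generator C ∧
      SemigroupWeiss.StrongTwoWeissWith S.generator C (α * β / (1 + β)) := by
  open SemigroupWeiss SemigroupWeiss.C0Semigroup in
  obtain ⟨Q, hQ, hQC⟩ := exists_comp_res_one hS hC hcomm
  have hγ : 0 < α * β / (1 + β) := by positivity
  have hγα : α * β / (1 + β) < α := by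
    rw [div_lt_iff₀ (by positivity)]
    nlinarith
  set γ := α * β / (1 + β) with hγ_def
  set n := ⌊α⌋₊ + 1 with hn
  have hαn : α < n := by rw [hn]; push_cast; exact Nat.lt_floor_add_one α
  have hfl : ⌊1 + α⌋₊ + 1 = n + 1 := by rw [add_comm 1 α, Nat.floor_add_one hα.le]
  have hdom : ∀ x, S.res 1 x ∈ S.generator.domain := by
    intro x
    rw [res_one]
    exact resolventOp_mem_domain _ _ x
  have hrT := res_commute_T (S := S) hS one_pos
  have H₁ : ∀ t : ℝ≥0, 0 < t → ∀ w,
      ‖Q (S.balak α n 1 (S.T t w))‖ ≤ M₁ * ‖(S.res 1 ^ (n + 1)) w‖ := by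
    intro t ht w
    -- As ⌊1 + α⌋ + 1 = n + 1, the vector x = R^(n+1) w lies in D((-A)^(1+α)). Of its n + 1
    -- resolvents, n are used by (-A)^α and the last one puts (-A)^α T(t)x into D(A).
    have hx := LinearPMap.mem_domain_of_mem_graph
      (mem_graph_negPow_res_pow hS (show 0 < 1 + α by positivity) w)
    rw [hfl] at hx
    have hg := mem_graph_negPow_res_pow hS hα (S.res 1 (S.T t w))
    have e1 : S.balak α n 1 (S.res 1 (S.T t w)) = S.res 1 (S.balak α n 1 (S.T t w)) :=
      congrArg (fun P : X →L[ℂ] X => P (S.T t w))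
        (commute_balak hS hα hαn one_pos hrT).eq.symm
    have e2 : (S.res 1 ^ n) (S.res 1 (S.T t w)) = S.T t ((S.res 1 ^ (n + 1)) w) := by
      rw [pow_succ]
      have := ((hrT t).pow_left (n + 1)).eq
      rw [pow_succ] at this
      exact congrArg (fun P : X →L[ℂ] X => P w) this
    rw [← hn, e1, e2] at hg
    obtain ⟨hy, e⟩ := pcomp_of_mem_graph (g := asOp C) hg (hdom _)
    have h := h₁ t ht _ hx ⟨_, hy⟩ rfl
    rw [e] at h
    rw [hQC _ (hdom _)]
    exact h
  have H₂ : ∀ t : ℝ≥0, 0 < t → ∀ w,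
      ‖Q (S.T t w)‖ ≤ M₂ * (t : ℝ) ^ (-((1 + β) / 2)) * ‖S.res 1 w‖ := by
    intro t ht w
    have ht' : (0 : ℝ) < t := ht
    have h := h₂ t ht ⟨S.res 1 w, hdom w⟩
    have e : S.res 1 (S.T t w) = S.T t (S.res 1 w) :=
      congrArg (fun P : X →L[ℂ] X => P w) (hrT t).eq
    have e' : (t : ℝ) ^ (-((1 + β) / 2)) = (√((t : ℝ) ^ (1 + β)))⁻¹ := by
      rw [Real.sqrt_eq_rpow, ← Real.rpow_mul ht'.le, Real.rpow_neg ht'.le]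
      congr 2
      ring
    rw [hQC _ (hdom _), e', ← div_eq_mul_inv]
    convert h using 3
    exact Subtype.ext e
  obtain ⟨K, -, hK⟩ := exists_norm_balak_comp_le hS hγ hγα hαn Q hQ hM₁.le hM₂.le H₁ H₂
  -- This determines γ: 1 - γ/α = 1/(1+β).
  have hexp : -((1 + β) / 2) * (1 - γ / α) = -(1 / 2) := by
    rw [hγ_def]
    field_simp
    ring
  rw [hexp] at hK
  have main : StrongTwoWeissWith S.generator C γ :=
    strongTwoWeissWith_of_le hS hγ
      (Nat.succ_le_succ (Nat.floor_le_floor hγα.le)) hQ hQC hK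
  exact ⟨⟨γ, hγ, main⟩, main⟩
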